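/- Let $\rho,\tau,b\ge 0$ and $\gamma\in(0,\infty)$ be fixed. For $N\ge 1$ let $\mathbb{S}^N=\{x\in\mathbb{R}^N:\|x\|_2^2=N\}$. For positive integers $n,p$ let $W\in\mathbb{R}^{n\times n}$ be a random symmetric matrix with $W_{ij}=W_{ji}\sim\mathsf{N}(0,\rho/n)$ for $i<j$ and $W_{ii}\sim\mathsf{N}(0,2\rho/n)$, and let $Z\in\mathbb{R}^{p\times n}$ have entries $Z_{ai}\sim\mathsf{N}(0,\tau/p)$, where the variables $(W_{ij})_{i\le j}$ and $(Z_{ai})_{a,i}$ are all independent. For fixed vectors $v_0\in\{\pm1\}^n$, $u_0\in\mathbb{S}^p$ and parameters $\lambda\in\mathbb{R}$, $\mu\ge 0$, put $$\mathsf{OPT}(\lambda,\mu,b)=\frac1n\,\mathbb{E}\max_{(x,y)\in\mathbb{S}^n\times\mathbb{S}^p}\Big[\frac{\lambda}{n}\langle x,v_0\rangle^2+\langle x,Wx\rangle+b\Big(\sqrt{\frac{\mu}{np}}\,\langle x,v_0\rangle\langle y,u_0\rangle+\langle y,Zx\rangle\Big)\Big].$$ Then, in the null case $\lambda=\mu=0$,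 as $n,p\to\infty$ with $n/p\to\gamma$, $$\mathsf{OPT}(0,0,b)\;\longrightarrow\;\sqrt{4\rho+b^2\tau}+b\sqrt{\frac{\tau}{\gamma}}.$$ -/

import Mathlib

open MeasureTheory ProbabilityTheory Filter Topology Matrix
open scoped NNReal

/-- The sphere of radius `√N` in `ℝ^N`: vectors with squared Euclidean norm `N`. -/
def normSphere (N : ℕ) : Set (Fin N → ℝ) := {x | x ⬝ᵥ x = (N : ℝ)}

/-- The symmetric matrix whose `(i, j)` and `(j, i)` entries are both the coordinate of `w`
at the unordered pair `{i, j}`. -/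
def symMatrix {n : ℕ} (w : Sym2 (Fin n) → ℝ) : Matrix (Fin n) (Fin n) ℝ :=
  Matrix.of fun i j => w s(i, j)

/-- The matrix with entries `z (a, i)`. -/
def rectMatrix {p n : ℕ} (z : Fin p × Fin n → ℝ) : Matrix (Fin p) (Fin n) ℝ :=
  Matrix.of fun a i => z (a, i)

/-- Joint law of the free entries of the symmetric matrix `W`: they are independent, centred
Gaussian, of variance `2ρ/n` on the diagonal and `ρ/n` off the diagonal. -/
noncomputable def symNoise (n : ℕ) (ρ : ℝ≥0) : Measure (Sym2 (Fin n) → ℝ) :=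
  Measure.pi fun e => gaussianReal 0 (if e.IsDiag then 2 * ρ / (n : ℝ≥0) else ρ / (n : ℝ≥0))

/-- Joint law of the entries of the `p × n` matrix `Z`: independent `N(0, τ/p)`. -/
noncomputable def rectNoise (p n : ℕ) (τ : ℝ≥0) : Measure (Fin p × Fin n → ℝ) :=
  Measure.pi fun _ => gaussianReal 0 (τ / (p : ℝ≥0))

/-- Joint law of the entries of `W` and `Z`, which are independent of one another. -/
noncomputable def noise (n p : ℕ) (ρ τ : ℝ≥0) :
    Measure ((Sym2 (Fin n) → ℝ) × (Fin p × Fin n → ℝ)) :=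
  (symNoise n ρ).prod (rectNoise p n τ)

/-- The function of `(x, y)` that is maximised. -/
noncomputable def objective {n p : ℕ} (lam mu b : ℝ) (v₀ : Fin n → ℝ) (u₀ : Fin p → ℝ)
    (W : Matrix (Fin n) (Fin n) ℝ) (Z : Matrix (Fin p) (Fin n) ℝ)
    (q : (Fin n → ℝ) × (Fin p → ℝ)) : ℝ :=
  (lam / n * (q.1 ⬝ᵥ v₀) ^ 2 + q.1 ⬝ᵥ (W *ᵥ q.1)) +
    b * (√(mu / (n * p)) * (q.1 ⬝ᵥ v₀) * (q.2 ⬝ᵥ u₀) + q.2 ⬝ᵥ (Z *ᵥ q.1))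

/-- The maximum of the objective over the product of spheres. -/
noncomputable def maxValue {n p : ℕ} (lam mu b : ℝ) (v₀ : Fin n → ℝ) (u₀ : Fin p → ℝ)
    (W : Matrix (Fin n) (Fin n) ℝ) (Z : Matrix (Fin p) (Fin n) ℝ) : ℝ :=
  sSup (objective lam mu b v₀ u₀ W Z '' (normSphere n ×ˢ normSphere p))

/-- The normalised expected optimum `OPT(λ, μ, b)`. -/
noncomputable def OPT {n p : ℕ} (ρ τ : ℝ≥0) (v₀ : Fin n → ℝ) (u₀ : Fin p → ℝ)
    (lam mu b : ℝ) : ℝ :=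
  1 / (n : ℝ) *
    ∫ ω, maxValue lam mu b v₀ u₀ (symMatrix ω.1) (rectMatrix ω.2) ∂(noise n p ρ τ)

/-! The maximum is attained and its expectation exists, so `maxValue` and `OPT` never take
default values. -/

theorem abs_le_of_mem_normSphere {N : ℕ} {x : Fin N → ℝ} (hx : x ∈ normSphere N) (i : Fin N) :
    |x i| ≤ √(N : ℝ) := by
  apply Real.abs_le_sqrt
  have hx' : ∑ j, x j * x j = (N : ℝ) := hx
  rw [← hx', pow_two]
  exact Finset.single_le_sum (f := fun j => x j * x j) (fun j _ => mul_self_nonneg _)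
    (Finset.mem_univ i)

theorem isCompact_normSphere (N : ℕ) : IsCompact (normSphere N) := by
  apply Metric.isCompact_of_isClosed_isBounded
  · exact isClosed_eq (by unfold dotProduct; fun_prop) continuous_const
  · apply Metric.isBounded_closedBall (x := 0) (r := √(N : ℝ)) |>.subset
    intro x hx
    rw [mem_closedBall_zero_iff, pi_norm_le_iff_of_nonneg (Real.sqrt_nonneg _)]
    exact fun i => abs_le_of_mem_normSphere hx i

theorem normSphere_nonempty (N : ℕ) : (normSphere N).Nonempty :=
  ⟨fun _ => 1, by simp [normSphere, dotProduct]⟩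

theorem continuous_objective {n p : ℕ} (lam mu b : ℝ) (v₀ : Fin n → ℝ) (u₀ : Fin p → ℝ) :
    Continuous fun r : ((Sym2 (Fin n) → ℝ) × (Fin p × Fin n → ℝ)) ×
        ((Fin n → ℝ) × (Fin p → ℝ)) =>
      objective lam mu b v₀ u₀ (symMatrix r.1.1) (rectMatrix r.1.2) r.2 := by
  simp only [objective, symMatrix, rectMatrix, dotProduct, mulVec, Matrix.of_apply]
  fun_prop

/-- `maxValue` is a genuine maximum. -/
theorem isGreatest_maxValue {n p : ℕ} (lam mu b : ℝ) (v₀ : Fin n → ℝ) (u₀ : Fin p → ℝ)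
    (W : Matrix (Fin n) (Fin n) ℝ) (Z : Matrix (Fin p) (Fin n) ℝ) :
    IsGreatest (objective lam mu b v₀ u₀ W Z '' (normSphere n ×ˢ normSphere p))
      (maxValue lam mu b v₀ u₀ W Z) := by
  apply IsCompact.isGreatest_sSup
  · apply ((isCompact_normSphere n).prod (isCompact_normSphere p)).image
    unfold objective dotProduct mulVec dotProduct
    fun_prop
  · exact ((normSphere_nonempty n).prod (normSphere_nonempty p)).image _

instance isProbabilityMeasure_symNoise (n : ℕ) (ρ : ℝ≥0) :
    IsProbabilityMeasure (symNoise n ρ) := by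
  unfold symNoise; infer_instance

instance isProbabilityMeasure_rectNoise (p n : ℕ) (τ : ℝ≥0) :
    IsProbabilityMeasure (rectNoise p n τ) := by
  unfold rectNoise; infer_instance

instance isProbabilityMeasure_noise (n p : ℕ) (ρ τ : ℝ≥0) :
    IsProbabilityMeasure (noise n p ρ τ) := by
  unfold noise; infer_instance

theorem abs_dotProduct_le {N : ℕ} {x : Fin N → ℝ} (hx : x ∈ normSphere N) (v : Fin N → ℝ) :
    |x ⬝ᵥ v| ≤ √(N : ℝ) * ∑ i, |v i| := by
  rw [Finset.mul_sum]
  refine (Finset.abs_sum_le_sum_abs _ _).trans (Finset.sum_le_sum fun i _ => ?_)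
  rw [abs_mul]
  exact mul_le_mul_of_nonneg_right (abs_le_of_mem_normSphere hx i) (abs_nonneg _)

theorem abs_bilinear_le {M N : ℕ} {x : Fin N → ℝ} {y : Fin M → ℝ} (hx : x ∈ normSphere N)
    (hy : y ∈ normSphere M) (A : Matrix (Fin M) (Fin N) ℝ) :
    |y ⬝ᵥ (A *ᵥ x)| ≤ √(M : ℝ) * ∑ i, √(N : ℝ) * ∑ j, |A i j| := by
  refine (abs_dotProduct_le hy _).trans ?_
  gcongr with i
  rw [mulVec, dotProduct_comm]
  exact abs_dotProduct_le hx _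

/-- The maximum is integrable, so that its expectation is well defined. -/
theorem integrable_maxValue {n p : ℕ} (ρ τ : ℝ≥0) (lam mu b : ℝ) (v₀ : Fin n → ℝ)
    (u₀ : Fin p → ℝ) :
    Integrable (fun ω => maxValue lam mu b v₀ u₀ (symMatrix ω.1) (rectMatrix ω.2))
      (noise n p ρ τ) := by
  have hc : Continuous fun ω : (Sym2 (Fin n) → ℝ) × (Fin p × Fin n → ℝ) =>
      maxValue lam mu b v₀ u₀ (symMatrix ω.1) (rectMatrix ω.2) :=
    IsCompact.continuous_sSup ((isCompact_normSphere n).prod (isCompact_normSphere p))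
      (continuous_objective lam mu b v₀ u₀)
  have hg : ∀ v : ℝ≥0, Integrable (fun x : ℝ => |x|) (gaussianReal 0 v) := fun v =>
    ((memLp_id_gaussianReal' (μ := 0) (v := v) 1 (by simp)).integrable le_rfl).abs
  have hw : ∀ i j : Fin n, Integrable (fun ω : (Sym2 (Fin n) → ℝ) × (Fin p × Fin n → ℝ) =>
      |symMatrix ω.1 i j|) (noise n p ρ τ) := fun i j =>
    Integrable.comp_fst (f := fun w : Sym2 (Fin n) → ℝ => |w s(i, j)|)
      (by unfold symNoise
          exact integrable_comp_eval (X := fun _ : Sym2 (Fin n) => ℝ) (i := s(i, j))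
            (f := fun x : ℝ => |x|) (hg _)) _
  have hz : ∀ (a : Fin p) (i : Fin n),
      Integrable (fun ω : (Sym2 (Fin n) → ℝ) × (Fin p × Fin n → ℝ) =>
        |rectMatrix ω.2 a i|) (noise n p ρ τ) := fun a i =>
    Integrable.comp_snd (f := fun z : Fin p × Fin n → ℝ => |z (a, i)|)
      (by unfold rectNoise
          exact integrable_comp_eval (X := fun _ : Fin p × Fin n => ℝ) (i := (a, i))
            (f := fun x : ℝ => |x|) (hg _)) _
  refine Integrable.mono' (g := fun ω =>
    (|lam / n| * (√(n : ℝ) * ∑ i, |v₀ i|) ^ 2 +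
      √(n : ℝ) * ∑ i, √(n : ℝ) * ∑ j, |symMatrix ω.1 i j|) +
    |b| * (√(mu / (n * p)) * (√(n : ℝ) * ∑ i, |v₀ i|) * (√(p : ℝ) * ∑ i, |u₀ i|) +
      √(p : ℝ) * ∑ a, √(n : ℝ) * ∑ i, |rectMatrix ω.2 a i|)) ?_
    hc.aestronglyMeasurable (Eventually.of_forall fun ω => ?_)
  · refine ((integrable_const _).add ((integrable_finsetSum _ fun i _ =>
      (integrable_finsetSum _ fun j _ => hw i j).const_mul _).const_mul _)).add
      (((integrable_const _).add ((integrable_finsetSum _ fun i _ =>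
      (integrable_finsetSum _ fun j _ => hz i j).const_mul _).const_mul _)).const_mul _)
  · obtain ⟨⟨x, y⟩, ⟨hx, hy⟩, h⟩ :=
      (isGreatest_maxValue lam mu b v₀ u₀ (symMatrix ω.1) (rectMatrix ω.2)).1
    rw [Real.norm_eq_abs, ← h, objective]
    refine (abs_add_le _ _).trans (add_le_add ((abs_add_le _ _).trans (add_le_add ?_ ?_)) ?_)
    · rw [abs_mul, abs_pow]
      gcongr
      exact abs_dotProduct_le hx _
    · exact abs_bilinear_le hx hx _
    · rw [abs_mul]
      refine mul_le_mul_of_nonneg_left ((abs_add_le _ _).trans (add_le_add ?_ ?_)) (abs_nonneg _)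
      · rw [abs_mul, abs_mul, abs_of_nonneg (Real.sqrt_nonneg _)]
        gcongr
        · exact abs_dotProduct_le hx _
        · exact abs_dotProduct_le hy _
      · exact abs_bilinear_le hx hy _

/-! With no signal, the objective is a centred Gaussian process on the product of spheres. Its
covariance depends only on `u = ⟨x, x'⟩` and `w = ⟨y, y'⟩`, and equals `(2ρ/n) u² + b² (τ/p) u w`.
The optimum is `1/n` times its expected supremum (`OPT_zero_zero_eq`). Both bounds rest on
Sudakov–Fernique (`gaussianWidth_le`): expected suprema are monotone in the increments `E (X_t -
X_s)²`. In particular they agree when the increments agree, so only covariances need to be computed.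

Upper bound: the increments are dominated by those of the linear process `α ⟨x, g⟩ + β ⟨y, h⟩` with
`α² = 4ρ + b²τ` and `β² = b²τn/p`. By Cauchy–Schwarz the supremum of the latter is at most `α √n ‖g‖
+ β √p ‖h‖`, and `E ‖g‖ ≤ √n`, `E ‖h‖ ≤ √p`.

Lower bound: a near-maximiser is built greedily, in the spirit of Householder bidiagonalisation.
With the first coordinate of `x` pinned to `1`, one column of the rectangular matrix acts on `y` as
a linear field; giving `y` a unit component along it gains `d E ‖g‖`. That component exposes a row,
which joins the exposed row and column of the square matrix in a linear field on the rest of `x`, of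
scale `L` with `L² = 2c² + d²`; aligning `x` gains `L E ‖g‖`. What remains is the same problem in
smaller dimensions and with fresh noise (`add_pinnedWidth_le`). After `k` rounds and rescaling to
the original spheres, this gives the fraction `k/(k+1)` of the upper bound up to an error `O(1/√n)`
for fixed `k`. Letting `n, p → ∞` for each `k`, with `k` arbitrarily large, closes the gap. -/

/-! ### Gaussian integration by parts. -/

/-- Integration by parts for the standard Gaussian measure on the line. -/
theorem integral_mul_gaussianReal_eq_integral_deriv {f f' : ℝ → ℝ} {C C' : ℝ}
    (hf : ∀ x, HasDerivAt f (f' x) x) (hC : ∀ x, |f x| ≤ C) (hf' : Continuous f')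
    (hC' : ∀ x, |f' x| ≤ C') :
    ∫ x, x * f x ∂gaussianReal 0 1 = ∫ x, f' x ∂gaussianReal 0 1 := by
  have hfc : Continuous f := continuous_iff_continuousAt.2 fun x => (hf x).continuousAt
  set φ : ℝ → ℝ := gaussianPDFReal 0 1 with hφ
  have hφi : Integrable φ := integrable_gaussianPDFReal 0 1
  have hφd : ∀ x, HasDerivAt φ (-(x * φ x)) x := by
    intro x
    have h1 : HasDerivAt (fun x : ℝ => -(x - 0) ^ 2 / (2 * ((1 : ℝ≥0) : ℝ))) (-x) x := by
      have := (((hasDerivAt_id x).sub_const 0).pow 2).neg.div_const (2 * ((1 : ℝ≥0) : ℝ))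
      refine this.congr_deriv ?_
      simp
      ring
    have h2 := h1.exp.const_mul ((√(2 * Real.pi * ((1 : ℝ≥0) : ℝ)))⁻¹)
    refine h2.congr_deriv ?_
    rw [hφ, gaussianPDFReal_def]
    ring
  have hxφ : Integrable fun x => x * φ x := by
    have h : Integrable (fun x : ℝ => x) (gaussianReal 0 1) :=
      (memLp_id_gaussianReal' (μ := 0) (v := 1) 1 (by simp)).integrable le_rfl
    rw [gaussianReal_of_var_ne_zero 0 one_ne_zero] at h
    rw [integrable_withDensity_iff_integrable_smul' (measurable_gaussianPDF 0 1)
      (ae_of_all _ fun _ => gaussianPDF_lt_top)] at h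
    simpa [toReal_gaussianPDF, mul_comm] using h
  have key := integral_mul_deriv_eq_deriv_mul_of_integrable (u := f) (v := φ) (u' := f')
    (v' := fun x => -(x * φ x)) (fun x _ => hf x) (fun x _ => hφd x)
    (Integrable.bdd_mul hxφ.neg hfc.aestronglyMeasurable (ae_of_all _ hC))
    (Integrable.bdd_mul hφi hf'.aestronglyMeasurable (ae_of_all _ hC'))
    (Integrable.bdd_mul hφi hfc.aestronglyMeasurable (ae_of_all _ hC))
  rw [integral_gaussianReal_eq_integral_smul one_ne_zero,
    integral_gaussianReal_eq_integral_smul one_ne_zero]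
  simp only [smul_eq_mul]
  have h1 : ∫ x, f x * -(x * φ x) = -∫ x, φ x * (x * f x) := by
    rw [← integral_neg]; congr 1; ext x; ring
  have h2 : ∫ x, f' x * φ x = ∫ x, φ x * f' x := by
    congr 1; ext x; ring
  linarith

/-- The standard Gaussian measure on `ι → ℝ`. -/
noncomputable def stdGaussianPi (ι : Type*) [Fintype ι] : Measure (ι → ℝ) :=
  Measure.pi fun _ => gaussianReal 0 1

instance isProbabilityMeasure_stdGaussianPi (ι : Type*) [Fintype ι] :
    IsProbabilityMeasure (stdGaussianPi ι) := by
  unfold stdGaussianPi; infer_instance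

section Pi
variable {ι : Type*} [Fintype ι]

/-- Resampling one coordinate independently preserves a product law. This lets Fubini isolate
coordinate `i` without splitting the index type. -/
theorem measurePreserving_update_stdGaussianPi [DecidableEq ι] (i : ι) :
    MeasurePreserving (fun q : (ι → ℝ) × ℝ => Function.update q.1 i q.2)
      ((stdGaussianPi ι).prod (gaussianReal 0 1)) (stdGaussianPi ι) := by
  have hm : Measurable fun q : (ι → ℝ) × ℝ => Function.update q.1 i q.2 := by
    refine measurable_pi_iff.2 fun j => ?_
    by_cases h : j = i
    · subst h; simpa using measurable_snd
    · simp only [Function.update_of_ne h]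
      fun_prop
  refine ⟨hm, ?_⟩
  conv_rhs => rw [stdGaussianPi]
  refine (Measure.pi_eq fun s hs => ?_).symm
  rw [Measure.map_apply hm (MeasurableSet.univ_pi hs)]
  have : (fun q : (ι → ℝ) × ℝ => Function.update q.1 i q.2) ⁻¹' Set.univ.pi s =
      (Set.univ.pi (Function.update s i Set.univ)) ×ˢ s i := by
    ext ⟨g, x⟩
    simp only [Set.mem_preimage, Set.mem_univ_pi, Set.mem_prod]
    constructor
    · intro h
      refine ⟨fun j => ?_, by simpa using h i⟩
      by_cases hj : j = i
      · subst hj; simp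
      · simpa [Function.update_of_ne hj] using h j
    · rintro ⟨h, hx⟩ j
      by_cases hj : j = i
      · subst hj; simpa using hx
      · simpa [Function.update_of_ne hj] using h j
  rw [this, Measure.prod_prod, stdGaussianPi, Measure.pi_pi]
  rw [← Finset.prod_erase_mul Finset.univ _ (Finset.mem_univ i),
    ← Finset.prod_erase_mul Finset.univ (fun j => (gaussianReal 0 1) (s j)) (Finset.mem_univ i)]
  simp only [Function.update_self, measure_univ, mul_one]
  congr 1
  refine Finset.prod_congr rfl fun j hj => ?_
  rw [Function.update_of_ne (Finset.ne_of_mem_erase hj)]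

theorem integrable_comp_eval_stdGaussianPi (i : ι) {f : ℝ → ℝ}
    (hf : Integrable f (gaussianReal 0 1)) :
    Integrable (fun g : ι → ℝ => f (g i)) (stdGaussianPi ι) := by
  unfold stdGaussianPi
  exact integrable_comp_eval (X := fun _ : ι => ℝ) (i := i) hf

theorem integral_comp_eval_stdGaussianPi (i : ι) {f : ℝ → ℝ}
    (hf : AEStronglyMeasurable f (gaussianReal 0 1)) :
    ∫ g : ι → ℝ, f (g i) ∂stdGaussianPi ι = ∫ x, f x ∂gaussianReal 0 1 := by
  unfold stdGaussianPi
  exact integral_comp_eval (X := fun _ : ι => ℝ) (i := i) hf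

theorem integrable_eval_stdGaussianPi (i : ι) :
    Integrable (fun g : ι → ℝ => g i) (stdGaussianPi ι) :=
  integrable_comp_eval_stdGaussianPi i
    ((memLp_id_gaussianReal' (μ := 0) (v := 1) 1 (by simp)).integrable le_rfl)

/-- Integration by parts in one coordinate for the standard Gaussian measure. -/
theorem integral_eval_mul_stdGaussianPi [DecidableEq ι] (i : ι) {F F' : (ι → ℝ) → ℝ} {C C' : ℝ}
    (hF : ∀ g x, HasDerivAt (fun x => F (Function.update g i x)) (F' (Function.update g i x)) x)
    (hFc : Continuous F) (hC : ∀ g, |F g| ≤ C) (hF' : Continuous F') (hC' : ∀ g, |F' g| ≤ C') :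
    ∫ g, g i * F g ∂stdGaussianPi ι = ∫ g, F' g ∂stdGaussianPi ι := by
  have hmp := measurePreserving_update_stdGaussianPi i
  have hi1 : Integrable (fun g : ι → ℝ => g i * F g) (stdGaussianPi ι) :=
    (integrable_eval_stdGaussianPi i).mul_bdd hFc.aestronglyMeasurable (ae_of_all _ hC)
  have hi2 : Integrable F' (stdGaussianPi ι) :=
    Integrable.of_bound hF'.aestronglyMeasurable C' (ae_of_all _ hC')
  have e1 := integral_map hmp.measurable.aemeasurable
    (f := fun g : ι → ℝ => g i * F g) (by rw [hmp.map_eq]; exact hi1.aestronglyMeasurable)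
  have e2 := integral_map hmp.measurable.aemeasurable
    (f := F') (by rw [hmp.map_eq]; exact hi2.aestronglyMeasurable)
  rw [hmp.map_eq] at e1 e2
  rw [e1, e2, integral_prod (fun q : (ι → ℝ) × ℝ => Function.update q.1 i q.2 i * F (Function.update q.1 i q.2))
      (hmp.integrable_comp_of_integrable hi1),
    integral_prod (fun q : (ι → ℝ) × ℝ => F' (Function.update q.1 i q.2))
      (hmp.integrable_comp_of_integrable hi2)]
  congr 1
  ext g
  simp only [Function.update_self]
  have hcu : Continuous fun x : ℝ => Function.update g i x := continuous_const.update i continuous_id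
  exact integral_mul_gaussianReal_eq_integral_deriv (hF g) (fun x => hC _)
    (hF'.comp hcu) (fun x => hC' _)

end Pi

/-! ### The smooth maximum and its Gibbs weights. -/

section LogSumExp
variable {T : Type*} [Fintype T]

/-- The smooth maximum `β⁻¹ log ∑ exp (β aₜ)`. -/
noncomputable def smoothMax (β : ℝ) (a : T → ℝ) : ℝ := β⁻¹ * Real.log (∑ t, Real.exp (β * a t))

/-- The Gibbs weights, which are the partial derivatives of `smoothMax β`. -/
noncomputable def gibbs (β : ℝ) (a : T → ℝ) (t : T) : ℝ :=
  Real.exp (β * a t) / ∑ s, Real.exp (β * a s)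

theorem gibbs_nonneg (β : ℝ) (a : T → ℝ) (t : T) : 0 ≤ gibbs β a t :=
  div_nonneg (Real.exp_pos _).le (Finset.sum_nonneg fun _ _ => (Real.exp_pos _).le)

theorem hasDerivAt_sum_exp {β : ℝ} {a a' : ℝ → T → ℝ} {θ : ℝ}
    (h : ∀ t, HasDerivAt (fun θ => a θ t) (a' θ t) θ) :
    HasDerivAt (fun θ => ∑ t, Real.exp (β * a θ t))
      (∑ t, Real.exp (β * a θ t) * (β * a' θ t)) θ :=
  HasDerivAt.fun_sum fun t _ => ((h t).const_mul β).exp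

variable [Nonempty T]

theorem sum_exp_pos (β : ℝ) (a : T → ℝ) : 0 < ∑ s, Real.exp (β * a s) :=
  Finset.sum_pos (fun _ _ => Real.exp_pos _) Finset.univ_nonempty

theorem sum_gibbs (β : ℝ) (a : T → ℝ) : ∑ t, gibbs β a t = 1 := by
  simp only [gibbs]
  rw [← Finset.sum_div, div_self (sum_exp_pos β a).ne']

theorem gibbs_le_one (β : ℝ) (a : T → ℝ) (t : T) : gibbs β a t ≤ 1 := by
  rw [← sum_gibbs β a]
  exact Finset.single_le_sum (fun s _ => gibbs_nonneg β a s) (Finset.mem_univ t)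

theorem hasDerivAt_smoothMax {β : ℝ} (hβ : β ≠ 0) {a a' : ℝ → T → ℝ} {θ : ℝ}
    (h : ∀ t, HasDerivAt (fun θ => a θ t) (a' θ t) θ) :
    HasDerivAt (fun θ => smoothMax β (a θ)) (∑ t, gibbs β (a θ) t * a' θ t) θ := by
  refine (((hasDerivAt_sum_exp h).log (sum_exp_pos β (a θ)).ne').const_mul β⁻¹).congr_deriv ?_
  simp only [gibbs]
  rw [Finset.sum_div, Finset.mul_sum]
  refine Finset.sum_congr rfl fun t _ => ?_
  field_simp

theorem hasDerivAt_gibbs {β : ℝ} {a a' : ℝ → T → ℝ} {θ : ℝ}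
    (h : ∀ t, HasDerivAt (fun θ => a θ t) (a' θ t) θ) (t : T) :
    HasDerivAt (fun θ => gibbs β (a θ) t)
      (β * gibbs β (a θ) t * (a' θ t - ∑ s, gibbs β (a θ) s * a' θ s)) θ := by
  refine ((((h t).const_mul β).exp).div (hasDerivAt_sum_exp h)
    (sum_exp_pos β (a θ)).ne').congr_deriv ?_
  have hS := (sum_exp_pos β (a θ)).ne'
  simp only [gibbs]
  have e1 : ∑ s, Real.exp (β * a θ s) * (β * a' θ s) =
      β * ∑ s, Real.exp (β * a θ s) * a' θ s := by
    rw [Finset.mul_sum]; exact Finset.sum_congr rfl fun s _ => by ring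
  have e2 : ∑ s, Real.exp (β * a θ s) / (∑ r, Real.exp (β * a θ r)) * a' θ s =
      (∑ s, Real.exp (β * a θ s) * a' θ s) / ∑ r, Real.exp (β * a θ r) := by
    rw [Finset.sum_div]; exact Finset.sum_congr rfl fun s _ => by ring
  rw [e1, e2]
  field_simp

theorem le_smoothMax {β : ℝ} (hβ : 0 < β) (a : T → ℝ) (t : T) : a t ≤ smoothMax β a := by
  have h : Real.exp (β * a t) ≤ ∑ s, Real.exp (β * a s) :=
    Finset.single_le_sum (f := fun s => Real.exp (β * a s)) (fun _ _ => (Real.exp_pos _).le)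
      (Finset.mem_univ t)
  have := (Real.le_log_iff_exp_le (sum_exp_pos β a)).2 h
  rw [smoothMax, inv_mul_eq_div, le_div_iff₀ hβ]
  linarith

theorem smoothMax_le {β M : ℝ} (hβ : 0 < β) {a : T → ℝ} (h : ∀ t, a t ≤ M) :
    smoothMax β a ≤ M + Real.log (Fintype.card T) / β := by
  have h1 : ∑ s, Real.exp (β * a s) ≤ Fintype.card T * Real.exp (β * M) := by
    rw [← nsmul_eq_mul, ← Finset.card_univ]
    refine Finset.sum_le_card_nsmul _ _ _ fun s _ => ?_
    gcongr
    exact h s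
  have hc : (0 : ℝ) < Fintype.card T := by exact_mod_cast Fintype.card_pos
  have h2 := Real.log_le_log (sum_exp_pos β a) h1
  rw [Real.log_mul hc.ne' (Real.exp_pos _).ne', Real.log_exp] at h2
  rw [smoothMax, inv_mul_eq_div, div_le_iff₀ hβ, add_mul, div_mul_cancel₀ _ hβ.ne']
  linarith

theorem continuous_smoothMax (β : ℝ) : Continuous fun a : T → ℝ => smoothMax β a := by
  unfold smoothMax
  refine continuous_const.mul (Continuous.log (by fun_prop) fun a => (sum_exp_pos β a).ne')

theorem continuous_gibbs (β : ℝ) (t : T) : Continuous fun a : T → ℝ => gibbs β a t := by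
  unfold gibbs
  exact Continuous.div (by fun_prop) (by fun_prop) fun a => (sum_exp_pos β a).ne'

theorem abs_sum_gibbs_mul_le {β C : ℝ} {a b : T → ℝ} (h : ∀ t, |b t| ≤ C) :
    |∑ t, gibbs β a t * b t| ≤ C := by
  calc |∑ t, gibbs β a t * b t| ≤ ∑ t, gibbs β a t * C := by
        refine (Finset.abs_sum_le_sum_abs _ _).trans (Finset.sum_le_sum fun t _ => ?_)
        rw [abs_mul, abs_of_nonneg (gibbs_nonneg β a t)]
        exact mul_le_mul_of_nonneg_left (h t) (gibbs_nonneg β a t)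
    _ = C := by rw [← Finset.sum_mul, sum_gibbs, one_mul]

end LogSumExp

/-! ### Differentiating the expected smooth maximum along a path of processes. -/

section Pi
variable {ι : Type*} [Fintype ι]

theorem abs_dotProduct_le_of_forall_abs_le {C : ℝ} {v : ι → ℝ} (h : ∀ i, |v i| ≤ C) (g : ι → ℝ) :
    |v ⬝ᵥ g| ≤ C * ∑ i, |g i| := by
  rw [Finset.mul_sum]
  refine (Finset.abs_sum_le_sum_abs _ _).trans (Finset.sum_le_sum fun i _ => ?_)
  rw [abs_mul]
  exact mul_le_mul_of_nonneg_right (h i) (abs_nonneg _)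

theorem integrable_sum_abs_stdGaussianPi :
    Integrable (fun g : ι → ℝ => ∑ i, |g i|) (stdGaussianPi ι) :=
  integrable_finsetSum _ fun i _ => (integrable_eval_stdGaussianPi i).abs

variable {T : Type*} [Fintype T] [Nonempty T]

/-- Integration by parts in each coordinate turns the factor `g i` into a derivative of a Gibbs
weight. As the weights sum to one, that derivative is an average of the differences `a t - a s`;
symmetrising in `t` and `s` produces the increments of `b` as well. Variances alone never appear, so
the later comparison needs hypotheses on increments only. -/
theorem integral_sum_gibbs_mul_dotProduct {β : ℝ} (a b : T → ι → ℝ) :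
    ∫ g, ∑ t, gibbs β (fun t => a t ⬝ᵥ g) t * (b t ⬝ᵥ g) ∂stdGaussianPi ι =
      β / 2 * ∫ g, ∑ t, ∑ s, gibbs β (fun t => a t ⬝ᵥ g) t * gibbs β (fun t => a t ⬝ᵥ g) s *
        ((b t - b s) ⬝ᵥ (a t - a s)) ∂stdGaussianPi ι := by
  classical
  set p : (ι → ℝ) → T → ℝ := fun g => gibbs β (fun t => a t ⬝ᵥ g) with hp
  have hlin : Continuous fun g : ι → ℝ => fun t => a t ⬝ᵥ g :=
    continuous_pi fun t => by unfold dotProduct; fun_prop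
  have hpc : ∀ t, Continuous fun g => p g t := fun t => (continuous_gibbs β t).comp hlin
  have hpb : ∀ g t, |p g t| ≤ 1 := fun g t => by
    rw [abs_of_nonneg (gibbs_nonneg _ _ _)]; exact gibbs_le_one _ _ _
  obtain ⟨C, hC⟩ : ∃ C, ∀ t i, |a t i| ≤ C := by
    obtain ⟨C, hC⟩ := (Set.finite_range fun q : T × ι => |a q.1 q.2|).bddAbove
    exact ⟨C, fun t i => hC ⟨(t, i), rfl⟩⟩
  have ibp : ∀ t i, ∫ g, g i * p g t ∂stdGaussianPi ι =
      ∫ g, β * p g t * (a t i - ∑ s, p g s * a s i) ∂stdGaussianPi ι := by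
    intro t i
    refine integral_eval_mul_stdGaussianPi i (C := 1) (C' := |β| * 1 * (C + C)) (fun g x => ?_)
      (hpc t) (fun g => hpb g t) ?_ fun g => ?_
    · refine hasDerivAt_gibbs (a := fun x t => a t ⬝ᵥ Function.update g i x)
        (a' := fun _ t => a t i) (fun s => ?_) t
      have h1 : HasDerivAt (fun x => Function.update g i x) (Pi.single i (1 : ℝ)) x :=
        hasDerivAt_update g i x
      have h2 : ∀ j, HasDerivAt (fun x => a s j * Function.update g i x j)
          (a s j * (Pi.single i (1 : ℝ) : ι → ℝ) j) x := fun j =>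
        ((hasDerivAt_pi.1 h1) j).const_mul _
      have h3 := HasDerivAt.fun_sum (u := Finset.univ) fun j _ => h2 j
      refine h3.congr_deriv ?_
      simp [Pi.single_apply]
    · have := hpc
      fun_prop
    · rw [abs_mul, abs_mul]
      gcongr
      · exact hpb g t
      · exact (abs_sub _ _).trans (add_le_add (hC t i) (abs_sum_gibbs_mul_le fun s => hC s i))
  have hgi : ∀ t i, Integrable (fun g : ι → ℝ => g i * p g t) (stdGaussianPi ι) := fun t i =>
    (integrable_eval_stdGaussianPi i).mul_bdd (hpc t).aestronglyMeasurable
      (ae_of_all _ fun g => hpb g t)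
  have hbi : ∀ {G : (ι → ℝ) → ℝ}, Continuous G → (∃ D, ∀ g, |G g| ≤ D) →
      Integrable G (stdGaussianPi ι) := fun hG ⟨D, hD⟩ =>
    Integrable.of_bound hG.aestronglyMeasurable D (ae_of_all _ hD)
  have hdi : ∀ t i, Integrable (fun g => β * p g t * (a t i - ∑ s, p g s * a s i))
      (stdGaussianPi ι) := by
    intro t i
    refine hbi ?_ ⟨|β| * 1 * (C + C), fun g => ?_⟩
    · have := hpc
      fun_prop
    · rw [abs_mul, abs_mul]
      gcongr
      · exact hpb g t
      · exact (abs_sub _ _).trans (add_le_add (hC t i) (abs_sum_gibbs_mul_le fun s => hC s i))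
  calc ∫ g, ∑ t, p g t * (b t ⬝ᵥ g) ∂stdGaussianPi ι
      = ∫ g, ∑ t, ∑ i, b t i * (g i * p g t) ∂stdGaussianPi ι := by
        congr 1; ext g
        refine Finset.sum_congr rfl fun t _ => ?_
        rw [dotProduct, Finset.mul_sum]
        exact Finset.sum_congr rfl fun i _ => by ring
    _ = ∑ t, ∑ i, b t i * ∫ g, g i * p g t ∂stdGaussianPi ι := by
        rw [integral_finsetSum _ fun t _ => integrable_finsetSum _ fun i _ => (hgi t i).const_mul _]
        refine Finset.sum_congr rfl fun t _ => ?_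
        rw [integral_finsetSum _ fun i _ => (hgi t i).const_mul _]
        exact Finset.sum_congr rfl fun i _ => integral_const_mul _ _
    _ = ∑ t, ∑ i, b t i * ∫ g, β * p g t * (a t i - ∑ s, p g s * a s i) ∂stdGaussianPi ι := by
        simp_rw [ibp]
    _ = ∫ g, ∑ t, ∑ i, b t i * (β * p g t * (a t i - ∑ s, p g s * a s i)) ∂stdGaussianPi ι := by
        rw [integral_finsetSum _ fun t _ => integrable_finsetSum _ fun i _ => (hdi t i).const_mul _]
        refine Finset.sum_congr rfl fun t _ => ?_
        rw [integral_finsetSum _ fun i _ => (hdi t i).const_mul _]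
        exact Finset.sum_congr rfl fun i _ => (integral_const_mul _ _).symm
    _ = _ := by
        rw [← integral_const_mul]
        congr 1; ext g
        have hsum : ∑ t, p g t = 1 := sum_gibbs _ _
        have e1 : ∑ t, ∑ i, b t i * (β * p g t * (a t i - ∑ s, p g s * a s i)) =
            β * ∑ t, ∑ s, p g t * p g s * (b t ⬝ᵥ (a t - a s)) := by
          rw [Finset.mul_sum]
          refine Finset.sum_congr rfl fun t _ => ?_
          simp only [dotProduct, Finset.mul_sum]
          rw [Finset.sum_comm]
          refine Finset.sum_congr rfl fun i _ => ?_
          have : a t i - ∑ s, p g s * a s i = ∑ s, p g s * (a t i - a s i) := by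
            simp_rw [mul_sub]
            rw [Finset.sum_sub_distrib, ← Finset.sum_mul, hsum, one_mul]
          rw [this, Finset.mul_sum, Finset.mul_sum]
          exact Finset.sum_congr rfl fun s _ => by simp only [Pi.sub_apply]; ring
        -- Exchanging `t` and `s` flips the sign of `a t - a s`; this is the source of the factor
        -- `1/2`.
        have e2 : ∑ t, ∑ s, p g t * p g s * (b t ⬝ᵥ (a t - a s)) =
            -∑ t, ∑ s, p g t * p g s * (b s ⬝ᵥ (a t - a s)) := by
          rw [Finset.sum_comm, ← Finset.sum_neg_distrib]
          refine Finset.sum_congr rfl fun t _ => ?_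
          rw [← Finset.sum_neg_distrib]
          refine Finset.sum_congr rfl fun s _ => ?_
          rw [← neg_sub (a t) (a s), dotProduct_neg]; ring
        have e3 : ∑ t, ∑ s, p g t * p g s * ((b t - b s) ⬝ᵥ (a t - a s)) =
            ∑ t, ∑ s, p g t * p g s * (b t ⬝ᵥ (a t - a s)) -
            ∑ t, ∑ s, p g t * p g s * (b s ⬝ᵥ (a t - a s)) := by
          rw [← Finset.sum_sub_distrib]
          refine Finset.sum_congr rfl fun t _ => ?_
          rw [← Finset.sum_sub_distrib]
          exact Finset.sum_congr rfl fun s _ => by rw [sub_dotProduct]; ring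
        rw [e1, e3]
        linear_combination (β / 2) * e2

theorem integrable_smoothMax {β C : ℝ} (hβ : 0 < β) {a : T → ι → ℝ} (hC : ∀ t i, |a t i| ≤ C) :
    Integrable (fun g : ι → ℝ => smoothMax β fun t => a t ⬝ᵥ g) (stdGaussianPi ι) := by
  have hlin : Continuous fun g : ι → ℝ => fun t => a t ⬝ᵥ g :=
    continuous_pi fun t => by unfold dotProduct; fun_prop
  refine Integrable.mono' (g := fun g => C * (∑ i, |g i|) + Real.log (Fintype.card T) / β)
    ((integrable_sum_abs_stdGaussianPi.const_mul C).add (integrable_const _))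
    ((continuous_smoothMax β).comp hlin).aestronglyMeasurable (ae_of_all _ fun g => ?_)
  have hb : ∀ t, |a t ⬝ᵥ g| ≤ C * ∑ i, |g i| := fun t =>
    abs_dotProduct_le_of_forall_abs_le (hC t) g
  have hlog : 0 ≤ Real.log (Fintype.card T) / β :=
    div_nonneg (Real.log_natCast_nonneg _) hβ.le
  obtain ⟨t₀⟩ := ‹Nonempty T›
  have : Nonempty T := ⟨t₀⟩
  rw [Real.norm_eq_abs, abs_le]
  constructor
  · have := le_smoothMax hβ (fun t => a t ⬝ᵥ g) t₀
    have := (abs_le.1 (hb t₀)).1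
    linarith
  · exact smoothMax_le hβ fun t => (abs_le.1 (hb t)).2

/-- Differentiation under the integral: the derivative is a Gibbs average of linear forms, hence
dominated by `C * ∑ i, |g i|` uniformly in `θ`. -/
theorem hasDerivAt_integral_smoothMax {β C : ℝ} (hβ : 0 < β) {χ χ' : ℝ → T → ι → ℝ}
    (hχ : ∀ θ t i, HasDerivAt (fun θ => χ θ t i) (χ' θ t i) θ) (hC : ∀ θ t i, |χ θ t i| ≤ C)
    (hC' : ∀ θ t i, |χ' θ t i| ≤ C) (θ : ℝ) :
    HasDerivAt (fun θ => ∫ g, smoothMax β (fun t => χ θ t ⬝ᵥ g) ∂stdGaussianPi ι)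
      (∫ g, ∑ t, gibbs β (fun t => χ θ t ⬝ᵥ g) t * (χ' θ t ⬝ᵥ g) ∂stdGaussianPi ι) θ := by
  have hlin : ∀ θ, Continuous fun g : ι → ℝ => fun t => χ θ t ⬝ᵥ g := fun θ =>
    continuous_pi fun t => by unfold dotProduct; fun_prop
  refine (hasDerivAt_integral_of_dominated_loc_of_deriv_le (s := Set.univ)
    (F := fun θ (g : ι → ℝ) => smoothMax β (fun t => χ θ t ⬝ᵥ g))
    (F' := fun θ (g : ι → ℝ) => ∑ t, gibbs β (fun t => χ θ t ⬝ᵥ g) t * (χ' θ t ⬝ᵥ g))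
    (bound := fun g => C * ∑ i, |g i|) Filter.univ_mem
    (Eventually.of_forall fun θ => ((continuous_smoothMax β).comp (hlin θ)).aestronglyMeasurable)
    (integrable_smoothMax hβ (hC θ)) ?_ ?_ (integrable_sum_abs_stdGaussianPi.const_mul C) ?_).2
  · have h1 : ∀ t, Continuous fun g : ι → ℝ => gibbs β (fun t => χ θ t ⬝ᵥ g) t := fun t =>
      (continuous_gibbs β t).comp (hlin θ)
    refine Continuous.aestronglyMeasurable (continuous_finsetSum _ fun t _ => (h1 t).mul ?_)
    unfold dotProduct; fun_prop
  · exact ae_of_all _ fun g θ _ =>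
      abs_sum_gibbs_mul_le fun t => abs_dotProduct_le_of_forall_abs_le (hC' θ t) g
  · refine ae_of_all _ fun g θ _ => hasDerivAt_smoothMax hβ.ne'
      (a := fun θ t => χ θ t ⬝ᵥ g) (a' := fun θ t => χ' θ t ⬝ᵥ g) fun t => ?_
    exact HasDerivAt.fun_sum fun i _ => (hχ θ t i).mul_const _

end Pi

/-! ### Gaussian widths and the Sudakov–Fernique inequality. -/

section Width
variable {ι κ T : Type*} [Fintype ι] [Fintype κ]

/-- The expected supremum of the Gaussian process `t ↦ φ t ⬝ᵥ g`, with `g` standard Gaussian. -/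
noncomputable def gaussianWidth (φ : T → ι → ℝ) : ℝ := ∫ g, ⨆ t, φ t ⬝ᵥ g ∂stdGaussianPi ι

theorem measurePreserving_sum_stdGaussianPi :
    MeasurePreserving (fun g : ι ⊕ κ → ℝ => (g ∘ Sum.inl, g ∘ Sum.inr)) (stdGaussianPi (ι ⊕ κ))
      ((stdGaussianPi ι).prod (stdGaussianPi κ)) := by
  unfold stdGaussianPi
  exact measurePreserving_sumPiEquivProdPi (X := fun _ : ι ⊕ κ => ℝ) (fun _ => gaussianReal 0 1)

theorem integral_comp_inl_stdGaussianPi {f : (ι → ℝ) → ℝ} (hf : Continuous f) :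
    ∫ g : ι ⊕ κ → ℝ, f (g ∘ Sum.inl) ∂stdGaussianPi (ι ⊕ κ) = ∫ g, f g ∂stdGaussianPi ι := by
  have h : MeasurePreserving (fun g : ι ⊕ κ → ℝ => g ∘ Sum.inl) (stdGaussianPi (ι ⊕ κ))
      (stdGaussianPi ι) := measurePreserving_fst.comp measurePreserving_sum_stdGaussianPi
  rw [← h.map_eq, integral_map h.measurable.aemeasurable hf.aestronglyMeasurable]

theorem integral_comp_inr_stdGaussianPi {f : (κ → ℝ) → ℝ} (hf : Continuous f) :
    ∫ g : ι ⊕ κ → ℝ, f (g ∘ Sum.inr) ∂stdGaussianPi (ι ⊕ κ) = ∫ g, f g ∂stdGaussianPi κ := by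
  have h : MeasurePreserving (fun g : ι ⊕ κ → ℝ => g ∘ Sum.inr) (stdGaussianPi (ι ⊕ κ))
      (stdGaussianPi κ) := measurePreserving_snd.comp measurePreserving_sum_stdGaussianPi
  rw [← h.map_eq, integral_map h.measurable.aemeasurable hf.aestronglyMeasurable]

theorem sumElim_dotProduct (a : ι → ℝ) (b : κ → ℝ) (g : ι ⊕ κ → ℝ) :
    Sum.elim a b ⬝ᵥ g = a ⬝ᵥ (g ∘ Sum.inl) + b ⬝ᵥ (g ∘ Sum.inr) := by
  simp [dotProduct, Fintype.sum_sum_type]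

section Finite
variable [Fintype T] [Nonempty T]

theorem continuous_smoothMax_dotProduct (β : ℝ) (φ : T → ι → ℝ) :
    Continuous fun g : ι → ℝ => smoothMax β fun t => φ t ⬝ᵥ g :=
  (continuous_smoothMax β).comp (continuous_pi fun t => by unfold dotProduct; fun_prop)

/-- Interpolate between independent copies by `cos θ • φ + sin θ • ψ` on `[0, π/2]`. The derivative
in `θ` is a nonnegative average of `sin θ cos θ` times the excess of the increments of `ψ` over
those of `φ`. -/
theorem integral_smoothMax_le {β : ℝ} (hβ : 0 < β) {φ : T → ι → ℝ} {ψ : T → κ → ℝ}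
    (h : ∀ t s, (φ t - φ s) ⬝ᵥ (φ t - φ s) ≤ (ψ t - ψ s) ⬝ᵥ (ψ t - ψ s)) :
    ∫ g, smoothMax β (fun t => φ t ⬝ᵥ g) ∂stdGaussianPi ι ≤
      ∫ g, smoothMax β (fun t => ψ t ⬝ᵥ g) ∂stdGaussianPi κ := by
  obtain ⟨C, hC⟩ : ∃ C, ∀ t i, |Sum.elim (φ t) (ψ t) i| ≤ C := by
    obtain ⟨C, hC⟩ := (Set.finite_range fun q : T × (ι ⊕ κ) =>
      |Sum.elim (φ q.1) (ψ q.1) q.2|).bddAbove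
    exact ⟨C, fun t i => hC ⟨(t, i), rfl⟩⟩
  set χ : ℝ → T → ι ⊕ κ → ℝ := fun θ t =>
    Sum.elim (Real.cos θ • φ t) (Real.sin θ • ψ t) with hχ
  set χ' : ℝ → T → ι ⊕ κ → ℝ := fun θ t =>
    Sum.elim (-Real.sin θ • φ t) (Real.cos θ • ψ t) with hχ'
  have hd : ∀ θ t i, HasDerivAt (fun θ => χ θ t i) (χ' θ t i) θ := by
    rintro θ t (i | i)
    · simpa [hχ, hχ'] using (Real.hasDerivAt_cos θ).mul_const (φ t i)
    · simpa [hχ, hχ'] using (Real.hasDerivAt_sin θ).mul_const (ψ t i)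
  have hmul : ∀ {c x : ℝ}, |c| ≤ 1 → |x| ≤ C → |c * x| ≤ C := fun {c x} hc hx => by
    rw [abs_mul]
    exact (mul_le_of_le_one_left (abs_nonneg _) hc).trans hx
  have hb : ∀ θ t i, |χ θ t i| ≤ C := by
    rintro θ t (i | i)
    · exact hmul (Real.abs_cos_le_one θ) (hC t (Sum.inl i))
    · exact hmul (Real.abs_sin_le_one θ) (hC t (Sum.inr i))
  have hb' : ∀ θ t i, |χ' θ t i| ≤ C := by
    rintro θ t (i | i)
    · exact hmul (by rw [abs_neg]; exact Real.abs_sin_le_one θ) (hC t (Sum.inl i))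
    · exact hmul (Real.abs_cos_le_one θ) (hC t (Sum.inr i))
  have hF := hasDerivAt_integral_smoothMax hβ hd hb hb'
  have hmono := monotoneOn_of_deriv_nonneg (convex_Icc (0 : ℝ) (Real.pi / 2))
    (fun θ _ => (hF θ).continuousAt.continuousWithinAt)
    (fun θ _ => (hF θ).differentiableAt.differentiableWithinAt) (fun θ hθ => ?_)
  · have h01 := hmono (Set.left_mem_Icc.2 Real.pi_div_two_pos.le)
      (Set.right_mem_Icc.2 Real.pi_div_two_pos.le) Real.pi_div_two_pos.le
    have e0 : ∀ g : ι ⊕ κ → ℝ, smoothMax β (fun t => χ 0 t ⬝ᵥ g) =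
        smoothMax β fun t => φ t ⬝ᵥ (g ∘ Sum.inl) := fun g => by
      congr 1; ext t; simp [hχ, sumElim_dotProduct]
    have e1 : ∀ g : ι ⊕ κ → ℝ, smoothMax β (fun t => χ (Real.pi / 2) t ⬝ᵥ g) =
        smoothMax β fun t => ψ t ⬝ᵥ (g ∘ Sum.inr) := fun g => by
      congr 1; ext t; simp [hχ, sumElim_dotProduct]
    simp only [e0, e1] at h01
    have q0 := integral_comp_inl_stdGaussianPi (κ := κ) (continuous_smoothMax_dotProduct β φ)
    have q1 := integral_comp_inr_stdGaussianPi (ι := ι) (continuous_smoothMax_dotProduct β ψ)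
    rwa [q0, q1] at h01
  · rw [interior_Icc] at hθ
    rw [(hF θ).deriv, integral_sum_gibbs_mul_dotProduct]
    refine mul_nonneg (by positivity) (integral_nonneg fun g => Finset.sum_nonneg fun t _ =>
      Finset.sum_nonneg fun s _ => mul_nonneg (mul_nonneg (gibbs_nonneg _ _ _)
        (gibbs_nonneg _ _ _)) ?_)
    have hsub : ∀ (a a' : ι → ℝ) (b b' : κ → ℝ),
        Sum.elim a b - Sum.elim a' b' = Sum.elim (a - a') (b - b') := by
      intro a a' b b'; ext (i | i) <;> simp
    have e : (χ' θ t - χ' θ s) ⬝ᵥ (χ θ t - χ θ s) = Real.sin θ * Real.cos θ *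
        ((ψ t - ψ s) ⬝ᵥ (ψ t - ψ s) - (φ t - φ s) ⬝ᵥ (φ t - φ s)) := by
      simp only [hχ, hχ', hsub, sumElim_dotProduct, Sum.elim_comp_inl, Sum.elim_comp_inr,
        ← smul_sub, smul_dotProduct, dotProduct_smul, smul_eq_mul]
      ring
    rw [e]
    have hs := Real.sin_pos_of_pos_of_lt_pi hθ.1 (by linarith [hθ.2, Real.pi_pos])
    have hc := Real.cos_pos_of_mem_Ioo ⟨by linarith [hθ.1, Real.pi_pos], hθ.2⟩
    exact mul_nonneg (mul_nonneg hs.le hc.le) (sub_nonneg.2 (h t s))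

end Finite

theorem bddAbove_range_dotProduct {C : ℝ} {φ : T → ι → ℝ} (hC : ∀ t i, |φ t i| ≤ C) (g : ι → ℝ) :
    BddAbove (Set.range fun t => φ t ⬝ᵥ g) :=
  ⟨C * ∑ i, |g i|, by
    rintro _ ⟨t, rfl⟩
    exact (le_abs_self _).trans (abs_dotProduct_le_of_forall_abs_le (hC t) g)⟩

variable [Nonempty T]

theorem abs_iSup_dotProduct_le {C : ℝ} {φ : T → ι → ℝ} (hC : ∀ t i, |φ t i| ≤ C) (g : ι → ℝ) :
    |⨆ t, φ t ⬝ᵥ g| ≤ C * ∑ i, |g i| := by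
  have hb : ∀ t, |φ t ⬝ᵥ g| ≤ C * ∑ i, |g i| := fun t =>
    abs_dotProduct_le_of_forall_abs_le (hC t) g
  obtain ⟨t⟩ := ‹Nonempty T›
  have : Nonempty T := ⟨t⟩
  exact abs_le.2 ⟨(abs_le.1 (hb t)).1.trans (le_ciSup (bddAbove_range_dotProduct hC g) t),
    ciSup_le fun t => (abs_le.1 (hb t)).2⟩

theorem continuous_iSup_dotProduct {C : ℝ} {φ : T → ι → ℝ} (hC : ∀ t i, |φ t i| ≤ C) :
    Continuous fun g : ι → ℝ => ⨆ t, φ t ⬝ᵥ g := by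
  have hC0 : 0 ≤ |C| * Fintype.card ι := by positivity
  refine (LipschitzWith.of_le_add_mul ⟨_, hC0⟩ fun g g' => ciSup_le fun t => ?_).continuous
  have h1 := le_ciSup (bddAbove_range_dotProduct hC g') t
  have h2 : φ t ⬝ᵥ g = φ t ⬝ᵥ g' + φ t ⬝ᵥ (g - g') := by rw [dotProduct_sub]; ring
  have h3 := (le_abs_self _).trans
    (abs_dotProduct_le_of_forall_abs_le (fun i => (hC t i).trans (le_abs_self C)) (g - g'))
  have h4 : ∑ i, |(g - g') i| ≤ Fintype.card ι * dist g g' := by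
    rw [← nsmul_eq_mul, ← Finset.card_univ]
    refine Finset.sum_le_card_nsmul _ _ _ fun i _ => ?_
    exact dist_le_pi_dist g g' i
  have h5 := mul_le_mul_of_nonneg_left h4 (abs_nonneg C)
  change φ t ⬝ᵥ g ≤ (⨆ t, φ t ⬝ᵥ g') + |C| * Fintype.card ι * dist g g'
  rw [h2]
  linarith

theorem integrable_iSup_dotProduct {C : ℝ} {φ : T → ι → ℝ} (hC : ∀ t i, |φ t i| ≤ C) :
    Integrable (fun g : ι → ℝ => ⨆ t, φ t ⬝ᵥ g) (stdGaussianPi ι) :=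
  Integrable.mono' (integrable_sum_abs_stdGaussianPi.const_mul C)
    (continuous_iSup_dotProduct hC).aestronglyMeasurable
    (ae_of_all _ fun g => abs_iSup_dotProduct_le hC g)

/-- The smooth maximum exceeds the true one by at most `log |T| / β`, which vanishes as `β → ∞`. -/
theorem gaussianWidth_le_of_finite [Fintype T] {φ : T → ι → ℝ} {ψ : T → κ → ℝ}
    (h : ∀ t s, (φ t - φ s) ⬝ᵥ (φ t - φ s) ≤ (ψ t - ψ s) ⬝ᵥ (ψ t - ψ s)) :
    gaussianWidth φ ≤ gaussianWidth ψ := by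
  obtain ⟨C, hC⟩ : ∃ C, ∀ t i, |φ t i| ≤ C := by
    obtain ⟨C, hC⟩ := (Set.finite_range fun q : T × ι => |φ q.1 q.2|).bddAbove
    exact ⟨C, fun t i => hC ⟨(t, i), rfl⟩⟩
  obtain ⟨D, hD⟩ : ∃ D, ∀ t i, |ψ t i| ≤ D := by
    obtain ⟨C, hC⟩ := (Set.finite_range fun q : T × κ => |ψ q.1 q.2|).bddAbove
    exact ⟨C, fun t i => hC ⟨(t, i), rfl⟩⟩
  have key : ∀ β : ℝ, 0 < β →
      gaussianWidth φ ≤ gaussianWidth ψ + Real.log (Fintype.card T) / β := by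
    intro β hβ
    calc gaussianWidth φ ≤ ∫ g, smoothMax β (fun t => φ t ⬝ᵥ g) ∂stdGaussianPi ι :=
          integral_mono (integrable_iSup_dotProduct hC) (integrable_smoothMax hβ hC)
            fun g => ciSup_le fun t => le_smoothMax hβ (fun t => φ t ⬝ᵥ g) t
      _ ≤ ∫ g, smoothMax β (fun t => ψ t ⬝ᵥ g) ∂stdGaussianPi κ := integral_smoothMax_le hβ h
      _ ≤ ∫ g, ((⨆ t, ψ t ⬝ᵥ g) + Real.log (Fintype.card T) / β) ∂stdGaussianPi κ :=
          integral_mono (integrable_smoothMax hβ hD)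
            ((integrable_iSup_dotProduct hD).add (integrable_const _))
            fun g => smoothMax_le hβ fun t => le_ciSup (bddAbove_range_dotProduct hD g) t
      _ = _ := by
          rw [integral_add (integrable_iSup_dotProduct hD) (integrable_const _)]
          simp [gaussianWidth]
  have hlim : Tendsto (fun β : ℝ => gaussianWidth ψ + Real.log (Fintype.card T) / β) atTop
      (𝓝 (gaussianWidth ψ + 0)) :=
    tendsto_const_nhds.add (tendsto_const_nhds.div_atTop tendsto_id)
  rw [add_zero] at hlim
  exact ge_of_tendsto hlim ((eventually_gt_atTop 0).mono key)

theorem gaussianWidth_comp_le {S : Type*} [Nonempty S] {C : ℝ} {φ : T → ι → ℝ}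
    (hC : ∀ t i, |φ t i| ≤ C) (r : S → T) :
    gaussianWidth (fun s => φ (r s)) ≤ gaussianWidth φ :=
  integral_mono (integrable_iSup_dotProduct fun s => hC (r s)) (integrable_iSup_dotProduct hC)
    fun g => ciSup_le fun s => le_ciSup (bddAbove_range_dotProduct hC g) (r s)

/-- The Sudakov–Fernique comparison inequality. -/
theorem gaussianWidth_le {C D : ℝ} {φ : T → ι → ℝ} {ψ : T → κ → ℝ}
    (hC : ∀ t i, |φ t i| ≤ C) (hD : ∀ t i, |ψ t i| ≤ D)
    (h : ∀ t s, (φ t - φ s) ⬝ᵥ (φ t - φ s) ≤ (ψ t - ψ s) ⬝ᵥ (ψ t - ψ s)) :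
    gaussianWidth φ ≤ gaussianWidth ψ := by
  set A : ℝ := ∫ g, ∑ i, |g i| ∂stdGaussianPi ι with hA
  have key : ∀ ε : ℝ, 0 < ε →
      gaussianWidth φ ≤ gaussianWidth ψ + √(Fintype.card κ) * ε * A := by
    intro ε hε
    -- The net is taken for `ψ`: the hypothesis on increments makes it a net for `φ` too. The factor
    -- `√(Fintype.card κ)` is the price of passing from sup-norm to Euclidean distance.
    have hbd : TotallyBounded (Set.range ψ) := by
      refine (isCompact_closedBall 0 |D|).totallyBounded.subset ?_
      rintro _ ⟨t, rfl⟩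
      rw [mem_closedBall_zero_iff, pi_norm_le_iff_of_nonneg (abs_nonneg D)]
      exact fun i => (hD t i).trans (le_abs_self D)
    obtain ⟨V, hVr, hVf, hV⟩ := Metric.finite_approx_of_totallyBounded hbd ε hε
    have : Fintype V := hVf.fintype
    choose r hr using fun v : V => hVr v.2
    have hnear : ∀ t, ∃ v : V, ∀ i, |ψ t i - ψ (r v) i| ≤ ε := by
      intro t
      obtain ⟨v, hv, htv⟩ := Set.mem_iUnion₂.1 (hV ⟨t, rfl⟩)
      refine ⟨⟨v, hv⟩, fun i => ?_⟩
      rw [hr ⟨v, hv⟩, ← Real.dist_eq]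
      exact (dist_le_pi_dist (ψ t) v i).trans (Metric.mem_ball.1 htv).le
    have hne : Nonempty V := (hnear (Classical.arbitrary T)).nonempty
    have hnear' : ∀ t, ∃ v : V, ∀ i, |(φ t - φ (r v)) i| ≤ √(Fintype.card κ) * ε := by
      intro t
      obtain ⟨v, hv⟩ := hnear t
      refine ⟨v, fun i => ?_⟩
      rw [← Real.sqrt_sq hε.le, ← Real.sqrt_mul (Nat.cast_nonneg _)]
      refine Real.abs_le_sqrt ?_
      calc (φ t - φ (r v)) i ^ 2 ≤ (φ t - φ (r v)) ⬝ᵥ (φ t - φ (r v)) := by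
            rw [pow_two]
            exact Finset.single_le_sum
              (f := fun j => (φ t - φ (r v)) j * (φ t - φ (r v)) j)
              (fun j _ => mul_self_nonneg _) (Finset.mem_univ i)
        _ ≤ (ψ t - ψ (r v)) ⬝ᵥ (ψ t - ψ (r v)) := h _ _
        _ ≤ Fintype.card κ * ε ^ 2 := by
            rw [← nsmul_eq_mul, ← Finset.card_univ]
            refine Finset.sum_le_card_nsmul _ _ _ fun j _ => ?_
            rw [← pow_two]
            exact sq_le_sq' (abs_le.1 (hv j)).1 (abs_le.1 (hv j)).2
    have hCr : ∀ (v : V) i, |φ (r v) i| ≤ C := fun v => hC (r v)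
    calc gaussianWidth φ
        ≤ ∫ g, ((⨆ v : V, φ (r v) ⬝ᵥ g) + √(Fintype.card κ) * ε * ∑ i, |g i|)
            ∂stdGaussianPi ι := by
          refine integral_mono (integrable_iSup_dotProduct hC)
            ((integrable_iSup_dotProduct hCr).add (integrable_sum_abs_stdGaussianPi.const_mul _))
            fun g => ciSup_le fun t => ?_
          obtain ⟨v, hv⟩ := hnear' t
          have h1 := le_ciSup (bddAbove_range_dotProduct hCr g) v
          have h2 := (le_abs_self _).trans (abs_dotProduct_le_of_forall_abs_le hv g)
          rw [sub_dotProduct] at h2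
          dsimp only
          linarith
      _ = gaussianWidth (fun v => φ (r v)) + √(Fintype.card κ) * ε * A := by
          rw [integral_add (integrable_iSup_dotProduct hCr)
            (integrable_sum_abs_stdGaussianPi.const_mul _), integral_const_mul]
          rfl
      _ ≤ gaussianWidth (fun v => ψ (r v)) + √(Fintype.card κ) * ε * A := by
          gcongr
          exact gaussianWidth_le_of_finite fun v w => h (r v) (r w)
      _ ≤ _ := by
          gcongr
          exact gaussianWidth_comp_le hD r
  have hlim : Tendsto (fun ε : ℝ => gaussianWidth ψ + √(Fintype.card κ) * ε * A) (𝓝[>] 0)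
      (𝓝 (gaussianWidth ψ + √(Fintype.card κ) * 0 * A)) :=
    Tendsto.mono_left (Continuous.tendsto (by fun_prop) _) nhdsWithin_le_nhds
  rw [mul_zero, zero_mul, add_zero] at hlim
  exact ge_of_tendsto hlim (eventually_mem_nhdsWithin.mono key)

/-! ### Conditioning, and lower bounds on widths. -/

/-- Conditioning on one block of coordinates, with a choice of sub-family for each of its values. -/
theorem add_le_gaussianWidth {C : ℝ} {a : T → ι → ℝ} {b : T → κ → ℝ} 
    (hab : ∀ t i, |Sum.elim (a t) (b t) i| ≤ C) {m : (ι → ℝ) → ℝ} (hm : Integrable m (stdGaussianPi ι)) {w : ℝ}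
    {S : Type*} [Nonempty S]
    (h : ∀ c, ∃ r : S → T, (∀ s, a (r s) ⬝ᵥ c = m c) ∧ w ≤ gaussianWidth fun s => b (r s)) :
    ∫ c, m c ∂stdGaussianPi ι + w ≤ gaussianWidth fun t => Sum.elim (a t) (b t) := by
  have hmp' : MeasurePreserving (fun q : (ι → ℝ) × (κ → ℝ) => Sum.elim q.1 q.2)
      ((stdGaussianPi ι).prod (stdGaussianPi κ)) (stdGaussianPi (ι ⊕ κ)) := by
    unfold stdGaussianPi
    exact measurePreserving_sumPiEquivProdPi_symm (X := fun _ : ι ⊕ κ => ℝ)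
      (fun _ => gaussianReal 0 1)
  have hint : Integrable (fun q : (ι → ℝ) × (κ → ℝ) => ⨆ t, Sum.elim (a t) (b t) ⬝ᵥ
      Sum.elim q.1 q.2) ((stdGaussianPi ι).prod (stdGaussianPi κ)) :=
    hmp'.integrable_comp_of_integrable (integrable_iSup_dotProduct hab)
  have e1 := integral_map (μ := (stdGaussianPi ι).prod (stdGaussianPi κ)) hmp'.measurable.aemeasurable
    (f := fun g => ⨆ t, Sum.elim (a t) (b t) ⬝ᵥ g)
    (continuous_iSup_dotProduct hab).aestronglyMeasurable
  rw [hmp'.map_eq] at e1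
  rw [gaussianWidth, e1, integral_prod _ hint]
  have e2 : ∫ c, m c ∂stdGaussianPi ι + w = ∫ c, (m c + w) ∂stdGaussianPi ι := by
    rw [integral_add hm (integrable_const _)]; simp
  rw [e2]
  have hae := (integrable_prod_iff hint.aestronglyMeasurable).1 hint |>.1
  refine integral_mono_ae (hm.add (integrable_const _)) hint.integral_prod_left ?_
  filter_upwards [hae] with c hc
  -- The sub-family may depend on `c` in a non-measurable way: it serves only to prove an inequality
  -- for each fixed `c`.
  obtain ⟨r, hr, hw⟩ := h c
  have hbr : ∀ s i, |b (r s) i| ≤ C := fun s i => hab (r s) (Sum.inr i)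
  calc m c + w ≤ m c + gaussianWidth fun s => b (r s) := by gcongr
    _ = ∫ g, (m c + ⨆ s, b (r s) ⬝ᵥ g) ∂stdGaussianPi κ := by
        rw [integral_add (integrable_const _) (integrable_iSup_dotProduct hbr)]
        simp [gaussianWidth]
    _ ≤ _ := by
        refine integral_mono ((integrable_const _).add (integrable_iSup_dotProduct hbr)) hc
          fun g => ?_
        have hle : (⨆ s, b (r s) ⬝ᵥ g) ≤ (⨆ t, Sum.elim (a t) (b t) ⬝ᵥ Sum.elim c g) - m c := by
          refine ciSup_le fun s => ?_
          have := le_ciSup (bddAbove_range_dotProduct hab (Sum.elim c g)) (r s)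
          rw [sumElim_dotProduct, Sum.elim_comp_inl, Sum.elim_comp_inr, hr s] at this
          linarith
        dsimp only
        linarith

/-- The supremum dominates any single member, which has mean zero. -/
theorem gaussianWidth_nonneg {C : ℝ} {φ : T → ι → ℝ} (hC : ∀ t i, |φ t i| ≤ C) :
    0 ≤ gaussianWidth φ := by
  have t := Classical.arbitrary T
  have hi : ∀ i, Integrable (fun g : ι → ℝ => φ t i * g i) (stdGaussianPi ι) := fun i =>
    (integrable_eval_stdGaussianPi i).const_mul _
  have h0 : ∫ g, φ t ⬝ᵥ g ∂stdGaussianPi ι = 0 := by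
    simp only [dotProduct]
    rw [integral_finsetSum _ fun i _ => hi i]
    refine Finset.sum_eq_zero fun i _ => ?_
    rw [integral_const_mul, integral_comp_eval_stdGaussianPi i (f := fun x => x)
      aestronglyMeasurable_id, integral_id_gaussianReal, mul_zero]
  rw [← h0]
  exact integral_mono (integrable_finsetSum _ fun i _ => hi i) (integrable_iSup_dotProduct hC)
    fun g => le_ciSup (bddAbove_range_dotProduct hC g) t

theorem abs_apply_le_sqrt_of_dotProduct_self_le {R : ℝ} {v : ι → ℝ} (h : v ⬝ᵥ v ≤ R) (i : ι) :
    |v i| ≤ √R := by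
  refine Real.abs_le_sqrt (le_trans ?_ h)
  rw [pow_two]
  exact Finset.single_le_sum (f := fun j => v j * v j) (fun j _ => mul_self_nonneg _)
    (Finset.mem_univ i)

theorem dotProduct_sub_self (a b : ι → ℝ) :
    (a - b) ⬝ᵥ (a - b) = a ⬝ᵥ a + b ⬝ᵥ b - 2 * (a ⬝ᵥ b) := by
  rw [sub_dotProduct, dotProduct_sub, dotProduct_sub, dotProduct_comm b a]
  ring

end Width

/-! ### The recursion for the pinned quadratic process. -/

/-- Pairs of vectors of prescribed squared Euclidean norms. -/
abbrev SpherePair (n p : ℕ) (r s : ℝ) : Type :=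
  {q : (Fin n → ℝ) × (Fin p → ℝ) // q.1 ⬝ᵥ q.1 = r ∧ q.2 ⬝ᵥ q.2 = s}

theorem nonempty_spherePair (n p : ℕ) {r s : ℝ} (hr : 0 ≤ r) (hs : 0 ≤ s) :
    Nonempty (SpherePair (n + 1) (p + 1) r s) :=
  ⟨⟨(Pi.single 0 √r, Pi.single 0 √s), by simp [Real.mul_self_sqrt hr],
    by simp [Real.mul_self_sqrt hs]⟩⟩

/-- Coefficients of `c ⟨x, A x⟩ + d ⟨y, B x⟩` as a linear form in the entries of `A` and `B`. -/
def quadraticFeature {n p : ℕ} (c d : ℝ) (x : Fin n → ℝ) (y : Fin p → ℝ) :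
    (Fin n × Fin n) ⊕ (Fin p × Fin n) → ℝ :=
  Sum.elim (fun q => c * (x q.1 * x q.2)) (fun q => d * (y q.1 * x q.2))

theorem tensor_dotProduct_tensor {ι κ : Type*} [Fintype ι] [Fintype κ] (c : ℝ) (x x' : ι → ℝ)
    (y y' : κ → ℝ) :
    (fun q : ι × κ => c * (x q.1 * y q.2)) ⬝ᵥ (fun q => c * (x' q.1 * y' q.2)) =
      c ^ 2 * ((x ⬝ᵥ x') * (y ⬝ᵥ y')) := by
  simp only [dotProduct]
  rw [Fintype.sum_prod_type, Finset.sum_mul_sum, Finset.mul_sum]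
  refine Finset.sum_congr rfl fun i _ => ?_
  rw [Finset.mul_sum]
  exact Finset.sum_congr rfl fun j _ => by ring

theorem quadraticFeature_dotProduct {n p : ℕ} (c d : ℝ) (x x' : Fin n → ℝ) (y y' : Fin p → ℝ) :
    quadraticFeature c d x y ⬝ᵥ quadraticFeature c d x' y' =
      c ^ 2 * ((x ⬝ᵥ x') * (x ⬝ᵥ x')) + d ^ 2 * ((y ⬝ᵥ y') * (x ⬝ᵥ x')) := by
  rw [quadraticFeature, quadraticFeature, sumElim_dotProduct_sumElim, tensor_dotProduct_tensor,
    tensor_dotProduct_tensor]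

/-- The expected Euclidean norm of a standard Gaussian vector. -/
noncomputable def gaussianMeanNorm (m : ℕ) : ℝ := ∫ g : Fin m → ℝ, √(g ⬝ᵥ g) ∂stdGaussianPi (Fin m)

theorem sqrt_dotProduct_self_le_sum_abs {m : ℕ} (g : Fin m → ℝ) : √(g ⬝ᵥ g) ≤ ∑ i, |g i| := by
  rw [Real.sqrt_le_left (Finset.sum_nonneg fun _ _ => abs_nonneg _)]
  calc g ⬝ᵥ g = ∑ i, |g i| ^ 2 := Finset.sum_congr rfl fun i _ => by rw [sq_abs]; ring
    _ ≤ (∑ i, |g i|) ^ 2 := Finset.sum_sq_le_sq_sum_of_nonneg fun _ _ => abs_nonneg _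

theorem integrable_sqrt_dotProduct_self (m : ℕ) :
    Integrable (fun g : Fin m → ℝ => √(g ⬝ᵥ g)) (stdGaussianPi (Fin m)) := by
  refine Integrable.mono' integrable_sum_abs_stdGaussianPi
    (Continuous.aestronglyMeasurable (by unfold dotProduct; fun_prop)) (ae_of_all _ fun g => ?_)
  rw [Real.norm_eq_abs, abs_of_nonneg (Real.sqrt_nonneg _)]
  exact sqrt_dotProduct_self_le_sum_abs g

/-- Some rotation maps the first coordinate vector to the direction of `c`. -/
theorem exists_rotation {m : ℕ} (c : Fin (m + 1) → ℝ) :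
    ∃ Q : (Fin (m + 1) → ℝ) → Fin (m + 1) → ℝ, (∀ x y, Q x ⬝ᵥ Q y = x ⬝ᵥ y) ∧
      ∀ x, Q x ⬝ᵥ c = √(c ⬝ᵥ c) * x 0 := by
  let E := EuclideanSpace ℝ (Fin (m + 1))
  let v : E := WithLp.toLp 2 c
  let e : E := WithLp.toLp 2 (Pi.single 0 √(c ⬝ᵥ c))
  have hin : ∀ a b : E, inner ℝ a b = (b.ofLp ⬝ᵥ a.ofLp) := fun a b => by
    rw [EuclideanSpace.inner_eq_star_dotProduct]; simp
  have hc : 0 ≤ c ⬝ᵥ c := Finset.sum_nonneg fun i _ => mul_self_nonneg _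
  have hn : ‖e‖ = ‖v‖ := by
    rw [← sq_eq_sq₀ (norm_nonneg _) (norm_nonneg _), ← real_inner_self_eq_norm_sq,
      ← real_inner_self_eq_norm_sq, hin, hin]
    simp [e, v, Real.mul_self_sqrt hc]
  -- The Householder reflection exchanging two vectors of equal norm; it is the identity when `e =
  -- v`.
  let R := (Submodule.span ℝ {e - v})ᗮ.reflection
  have hR : R e = v := Submodule.reflection_sub hn
  refine ⟨fun x => (R (WithLp.toLp 2 x)).ofLp, fun x y => ?_, fun x => ?_⟩
  · rw [← hin, R.inner_map_map, hin]
  · have : c = (R e).ofLp := by rw [hR]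
    conv_lhs => rw [this]
    rw [← hin, R.inner_map_map, hin]
    simp [e, mul_comm]

/-- Width of the quadratic process on the vectors `x` of first coordinate `1` and `y` with
`‖x‖² = ‖y‖² = k + 1`. -/
noncomputable def pinnedWidth (c d : ℝ) (n p k : ℕ) : ℝ :=
  gaussianWidth fun q : SpherePair n p k (k + 1) => quadraticFeature c d (vecCons 1 q.1.1) q.1.2

theorem abs_le_of_forall_dotProduct_self_eq {ι T : Type*} [Fintype ι] {R : ℝ} {φ : T → ι → ℝ}
    (h : ∀ t, φ t ⬝ᵥ φ t = R) (t : T) (i : ι) : |φ t i| ≤ √R :=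
  abs_apply_le_sqrt_of_dotProduct_self_le (h t).le i

/-- One greedy round. Each conditioning uses entries independent of the remaining ones, and rotating
a vector preserves the covariance of the unused part. The squared radii drop by one for both vectors
because each spends a unit component along an exposed field. -/
theorem add_pinnedWidth_le {c d L : ℝ} (hL : L ^ 2 = 2 * c ^ 2 + d ^ 2) (n p k : ℕ) :
    d * gaussianMeanNorm (p + 2) + L * gaussianMeanNorm (n + 2) + pinnedWidth c d (n + 1) (p + 1) k
      ≤ pinnedWidth c d (n + 2) (p + 2) (k + 1) := by
  have hk : (0 : ℝ) ≤ k := Nat.cast_nonneg k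
  have s2 : (√2) ^ 2 = (2 : ℝ) := Real.sq_sqrt (by norm_num)
  have : Nonempty (SpherePair (n + 2) (p + 2) (k + 1 : ℝ) (k + 2)) :=
    nonempty_spherePair _ _ (by positivity) (by positivity)
  have : Nonempty (SpherePair (n + 2) (p + 1) (k + 1 : ℝ) (k + 1)) :=
    nonempty_spherePair _ _ (by positivity) (by positivity)
  have : Nonempty (SpherePair (n + 1) (p + 1) (k : ℝ) (k + 1)) :=
    nonempty_spherePair _ _ (by positivity) (by positivity)
  have e0 : pinnedWidth c d (n + 2) (p + 2) (k + 1) =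
      gaussianWidth fun q : SpherePair (n + 2) (p + 2) (k + 1 : ℝ) (k + 2) =>
        quadraticFeature c d (vecCons 1 q.1.1) q.1.2 := by
    unfold pinnedWidth
    have h1 : ((k + 1 : ℕ) : ℝ) = k + 1 := by push_cast; ring
    have h2 : (k + 1 : ℝ) + 1 = k + 2 := by ring
    rw [h1, h2]
  -- Separate the part of the process that involves the first coordinate of `x`.
  have hA : gaussianWidth (fun q : SpherePair (n + 2) (p + 2) (k + 1 : ℝ) (k + 2) =>
      Sum.elim (d • q.1.2) (Sum.elim ((√2 * c) • q.1.1) (quadraticFeature c d q.1.1 q.1.2))) ≤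
      pinnedWidth c d (n + 2) (p + 2) (k + 1) := by
    rw [e0]
    refine gaussianWidth_le (abs_le_of_forall_dotProduct_self_eq (R := d ^ 2 * (k + 2) +
      (2 * c ^ 2 * (k + 1) + (c ^ 2 * ((k + 1) * (k + 1)) + d ^ 2 * ((k + 2) * (k + 1))))) ?_)
      (abs_le_of_forall_dotProduct_self_eq (R := c ^ 2 * ((k + 2) * (k + 2)) +
        d ^ 2 * ((k + 2) * (k + 2))) ?_) ?_
    · rintro ⟨⟨x, y⟩, hx, hy⟩
      simp only [sumElim_dotProduct_sumElim, quadraticFeature_dotProduct, smul_dotProduct,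
        dotProduct_smul, smul_eq_mul] at hx hy ⊢
      rw [hx, hy]
      linear_combination (c ^ 2 * (k + 1)) * s2
    · rintro ⟨⟨x, y⟩, hx, hy⟩
      simp only [quadraticFeature_dotProduct, cons_dotProduct_cons] at hx hy ⊢
      rw [hx, hy]
      ring
    · rintro ⟨⟨x, y⟩, hx, hy⟩ ⟨⟨x', y'⟩, hx', hy'⟩
      simp only [dotProduct_sub_self, sumElim_dotProduct_sumElim, quadraticFeature_dotProduct,
        smul_dotProduct, dotProduct_smul, smul_eq_mul, cons_dotProduct_cons] at hx hy hx' hy' ⊢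
      rw [hx, hy, hx', hy']
      refine le_of_eq ?_
      linear_combination (c ^ 2 * (2 * (k + 1) - 2 * (x ⬝ᵥ x'))) * s2
  -- Condition on the first column of the rectangular matrix.
  have hB : d * gaussianMeanNorm (p + 2) +
      gaussianWidth (fun q : SpherePair (n + 2) (p + 1) (k + 1 : ℝ) (k + 1) =>
        Sum.elim (L • q.1.1) (quadraticFeature c d q.1.1 q.1.2)) ≤
      gaussianWidth (fun q : SpherePair (n + 2) (p + 2) (k + 1 : ℝ) (k + 2) =>
        Sum.elim (d • q.1.2) (Sum.elim ((√2 * c) • q.1.1) (quadraticFeature c d q.1.1 q.1.2))) := by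
    rw [gaussianMeanNorm, ← integral_const_mul]
    refine add_le_gaussianWidth (S := SpherePair (n + 2) (p + 1) (k + 1 : ℝ) (k + 1))
      (abs_le_of_forall_dotProduct_self_eq (R := d ^ 2 * (k + 2) +
      (2 * c ^ 2 * (k + 1) + (c ^ 2 * ((k + 1) * (k + 1)) + d ^ 2 * ((k + 2) * (k + 1))))) ?_)
      ((integrable_sqrt_dotProduct_self _).const_mul d) fun z => ?_
    · rintro ⟨⟨x, y⟩, hx, hy⟩
      simp only [sumElim_dotProduct_sumElim, quadraticFeature_dotProduct, smul_dotProduct,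
        dotProduct_smul, smul_eq_mul] at hx hy ⊢
      rw [hx, hy]
      linear_combination (c ^ 2 * (k + 1)) * s2
    obtain ⟨Q, hQ, hQz⟩ := exists_rotation z
    -- The rotated `y` has component `1` along `z`, so its product with `z` is exactly `‖z‖`,
    -- whatever the other coordinates are.
    refine ⟨fun q => ⟨(q.1.1, Q (vecCons 1 q.1.2)), q.2.1, ?_⟩, fun q => ?_, ?_⟩
    · rw [hQ, cons_dotProduct_cons, q.2.2]; ring
    · simp [hQz]
    -- The unit component of `y` picks out a row of scale `d` acting on `x`; it merges with the
    -- field of scale `√2 * c` since independent variances add.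
    · refine gaussianWidth_le (abs_le_of_forall_dotProduct_self_eq (R := L ^ 2 * (k + 1) +
        (c ^ 2 * ((k + 1) * (k + 1)) + d ^ 2 * ((k + 1) * (k + 1)))) ?_)
        (abs_le_of_forall_dotProduct_self_eq (R := 2 * c ^ 2 * (k + 1) +
          (c ^ 2 * ((k + 1) * (k + 1)) + d ^ 2 * ((k + 2) * (k + 1)))) ?_) ?_
      · rintro ⟨⟨x, y⟩, hx, hy⟩
        simp only [sumElim_dotProduct_sumElim, quadraticFeature_dotProduct, smul_dotProduct,
          dotProduct_smul, smul_eq_mul] at hx hy ⊢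
        rw [hx, hy]
        ring
      · rintro ⟨⟨x, y⟩, hx, hy⟩
        simp only [sumElim_dotProduct_sumElim, quadraticFeature_dotProduct, smul_dotProduct,
          dotProduct_smul, smul_eq_mul, hQ, cons_dotProduct_cons] at hx hy ⊢
        rw [hx, hy]
        linear_combination (c ^ 2 * (k + 1)) * s2
      · rintro ⟨⟨x, y⟩, hx, hy⟩ ⟨⟨x', y'⟩, hx', hy'⟩
        simp only [dotProduct_sub_self, sumElim_dotProduct_sumElim, quadraticFeature_dotProduct,
          smul_dotProduct, dotProduct_smul, smul_eq_mul, hQ, cons_dotProduct_cons]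
          at hx hy hx' hy' ⊢
        rw [hx, hy, hx', hy']
        refine le_of_eq ?_
        linear_combination (2 * (k + 1) - 2 * (x ⬝ᵥ x')) * hL -
          (c ^ 2 * (2 * (k + 1) - 2 * (x ⬝ᵥ x'))) * s2
  -- Condition on the first row and column of the square matrix.
  have hC : L * gaussianMeanNorm (n + 2) + pinnedWidth c d (n + 1) (p + 1) k ≤
      gaussianWidth (fun q : SpherePair (n + 2) (p + 1) (k + 1 : ℝ) (k + 1) =>
        Sum.elim (L • q.1.1) (quadraticFeature c d q.1.1 q.1.2)) := by
    rw [gaussianMeanNorm, ← integral_const_mul]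
    refine add_le_gaussianWidth (S := SpherePair (n + 1) (p + 1) (k : ℝ) (k + 1))
      (abs_le_of_forall_dotProduct_self_eq (R := L ^ 2 * (k + 1) +
        (c ^ 2 * ((k + 1) * (k + 1)) + d ^ 2 * ((k + 1) * (k + 1)))) ?_)
      ((integrable_sqrt_dotProduct_self _).const_mul L) fun z => ?_
    · rintro ⟨⟨x, y⟩, hx, hy⟩
      simp only [sumElim_dotProduct_sumElim, quadraticFeature_dotProduct, smul_dotProduct,
        dotProduct_smul, smul_eq_mul] at hx hy ⊢
      rw [hx, hy]
      ring
    obtain ⟨Q, hQ, hQz⟩ := exists_rotation z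
    refine ⟨fun q => ⟨(Q (vecCons 1 q.1.1), q.1.2), ?_, q.2.2⟩, fun q => ?_, ?_⟩
    · rw [hQ, cons_dotProduct_cons, q.2.1]; ring
    · simp [hQz]
    · refine gaussianWidth_le (abs_le_of_forall_dotProduct_self_eq (R :=
        c ^ 2 * ((k + 1) * (k + 1)) + d ^ 2 * ((k + 1) * (k + 1))) ?_)
        (abs_le_of_forall_dotProduct_self_eq (R :=
          c ^ 2 * ((k + 1) * (k + 1)) + d ^ 2 * ((k + 1) * (k + 1))) ?_) ?_
      · rintro ⟨⟨x, y⟩, hx, hy⟩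
        simp only [quadraticFeature_dotProduct, cons_dotProduct_cons] at hx hy ⊢
        rw [hx, hy]
        ring
      · rintro ⟨⟨x, y⟩, hx, hy⟩
        simp only [quadraticFeature_dotProduct, hQ, cons_dotProduct_cons] at hx hy ⊢
        rw [hx, hy]
        ring
      · rintro ⟨⟨x, y⟩, hx, hy⟩ ⟨⟨x', y'⟩, hx', hy'⟩
        simp only [dotProduct_sub_self, quadraticFeature_dotProduct, hQ]
        exact le_rfl
  linarith

/-- Iterates the round `k` times and discards the remaining width, which is nonnegative. The index
`j` counts from the last, lowest-dimensional round. -/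
theorem sum_gaussianMeanNorm_le_pinnedWidth {c d L : ℝ} (hL : L ^ 2 = 2 * c ^ 2 + d ^ 2)
    (n p k : ℕ) :
    ∑ j ∈ Finset.range k,
        (d * gaussianMeanNorm (p + j + 2) + L * gaussianMeanNorm (n + j + 2)) ≤
      pinnedWidth c d (n + k + 1) (p + k + 1) k := by
  induction k with
  | zero =>
    have : Nonempty (SpherePair (n + 0 + 1) (p + 0 + 1) ((0 : ℕ) : ℝ) ((0 : ℕ) + 1)) :=
      nonempty_spherePair _ _ (by simp) (by simp)
    rw [Finset.range_zero, Finset.sum_empty]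
    refine gaussianWidth_nonneg
      (abs_le_of_forall_dotProduct_self_eq (R := c ^ 2 + d ^ 2) ?_)
    rintro ⟨⟨x, y⟩, hx, hy⟩
    simp only [quadraticFeature_dotProduct, cons_dotProduct_cons] at hx hy ⊢
    rw [hx, hy]
    push_cast
    ring
  | succ k ih =>
    rw [Finset.sum_range_succ]
    have := add_pinnedWidth_le hL (n + k) (p + k) k
    simp only [← Nat.add_assoc] at this ⊢
    linarith

/-! ### The expected norm of a Gaussian vector is `√m` up to a bounded error. -/

theorem memLp_sq_gaussianReal : MemLp (fun x : ℝ => x ^ 2) 2 (gaussianReal 0 1) := by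
  rw [memLp_two_iff_integrable_sq (by fun_prop)]
  have h : Integrable (fun x : ℝ => ‖x‖ ^ 4) (gaussianReal 0 1) :=
    (memLp_id_gaussianReal' (μ := 0) (v := 1) 4 (by simp)).integrable_norm_pow (by norm_num)
  refine h.congr (ae_of_all _ fun x => ?_)
  simp only [Real.norm_eq_abs]
  rw [← pow_mul, Even.pow_abs (by decide)]

theorem integral_sq_gaussianReal : ∫ x, x ^ 2 ∂gaussianReal 0 1 = 1 := by
  have h := variance_id_gaussianReal (μ := 0) (v := 1)
  rw [variance_eq_sub (memLp_id_gaussianReal' (μ := 0) (v := 1) 2 (by simp))] at h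
  simpa using h

theorem dotProduct_self_eq_sum_sq {ι : Type*} [Fintype ι] (g : ι → ℝ) : g ⬝ᵥ g = ∑ i, g i ^ 2 :=
  Finset.sum_congr rfl fun i _ => by ring

theorem integrable_dotProduct_self (m : ℕ) :
    Integrable (fun g : Fin m → ℝ => g ⬝ᵥ g) (stdGaussianPi (Fin m)) := by
  simp_rw [dotProduct_self_eq_sum_sq]
  exact integrable_finsetSum _ fun i _ =>
    integrable_comp_eval_stdGaussianPi i (memLp_sq_gaussianReal.integrable one_le_two)

theorem integral_dotProduct_self (m : ℕ) :
    ∫ g : Fin m → ℝ, g ⬝ᵥ g ∂stdGaussianPi (Fin m) = m := by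
  simp_rw [dotProduct_self_eq_sum_sq]
  rw [integral_finsetSum _ fun i _ =>
    integrable_comp_eval_stdGaussianPi i (memLp_sq_gaussianReal.integrable one_le_two)]
  rw [Finset.sum_congr rfl fun i _ => integral_comp_eval_stdGaussianPi i
    memLp_sq_gaussianReal.aestronglyMeasurable]
  simp [integral_sq_gaussianReal]

theorem memLp_dotProduct_self (m : ℕ) :
    MemLp (fun g : Fin m → ℝ => g ⬝ᵥ g) 2 (stdGaussianPi (Fin m)) := by
  simp_rw [dotProduct_self_eq_sum_sq]
  exact memLp_finsetSum _ fun i _ => memLp_sq_gaussianReal.comp_measurePreserving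
    (measurePreserving_eval (fun _ : Fin m => gaussianReal 0 1) i)

theorem integral_dotProduct_self_sq (m : ℕ) :
    ∫ g : Fin m → ℝ, (g ⬝ᵥ g) ^ 2 ∂stdGaussianPi (Fin m) =
      m ^ 2 + m * Var[fun x : ℝ => x ^ 2; gaussianReal 0 1] := by
  have h1 := variance_eq_sub (memLp_dotProduct_self m)
  have h2 : Var[fun g : Fin m → ℝ => g ⬝ᵥ g; stdGaussianPi (Fin m)] =
      m * Var[fun x : ℝ => x ^ 2; gaussianReal 0 1] := by
    have := variance_sum_pi (μ := fun _ : Fin m => gaussianReal 0 1)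
      (X := fun _ x => x ^ 2) fun _ => memLp_sq_gaussianReal
    rw [Finset.sum_const, Finset.card_univ, Fintype.card_fin, nsmul_eq_mul] at this
    rw [← this, stdGaussianPi]
    congr 1
    ext g
    simp [dotProduct_self_eq_sum_sq]
  rw [h2, integral_dotProduct_self] at h1
  simp only [Pi.pow_apply] at h1
  linarith

/-- Concavity: the square root lies below its tangent line at `m`, and `E ‖g‖² = m`. -/
theorem gaussianMeanNorm_le (m : ℕ) : gaussianMeanNorm m ≤ √m := by
  rcases Nat.eq_zero_or_pos m with rfl | hm
  · simp [gaussianMeanNorm]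
  have hm' : (0 : ℝ) < √m := Real.sqrt_pos.2 (by exact_mod_cast hm)
  have h : gaussianMeanNorm m ≤
      ∫ g : Fin m → ℝ, ((g ⬝ᵥ g) / (2 * √m) + √m / 2) ∂stdGaussianPi (Fin m) := by
    refine integral_mono (integrable_sqrt_dotProduct_self m)
      (((integrable_dotProduct_self m).div_const _).add (integrable_const _)) fun g => ?_
    have hg : 0 ≤ g ⬝ᵥ g := Finset.sum_nonneg fun i _ => mul_self_nonneg _
    have e : (g ⬝ᵥ g) / (2 * √m) + √m / 2 - √(g ⬝ᵥ g) = (√(g ⬝ᵥ g) - √m) ^ 2 / (2 * √m) := by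
      field_simp
      linear_combination -(Real.sq_sqrt hg)
    have : 0 ≤ (√(g ⬝ᵥ g) - √m) ^ 2 / (2 * √m) := by positivity
    dsimp only
    linarith
  rw [integral_add ((integrable_dotProduct_self m).div_const _) (integrable_const _),
    integral_div, integral_dotProduct_self] at h
  refine h.trans_eq ?_
  simp only [integral_const, probReal_univ, one_smul]
  field_simp
  linear_combination -(Real.sq_sqrt (Nat.cast_nonneg (α := ℝ) m))

/-- The norm is bounded below by a polynomial in its square, so second and fourth moments suffice.
The value of the variance is irrelevant; only its independence of `m` matters. -/
theorem le_gaussianMeanNorm {m : ℕ} (hm : 0 < m) :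
    √m - Var[fun x : ℝ => x ^ 2; gaussianReal 0 1] ≤ gaussianMeanNorm m := by
  set V := Var[fun x : ℝ => x ^ 2; gaussianReal 0 1]
  have hV : 0 ≤ V := variance_nonneg _ _
  have hm1 : (1 : ℝ) ≤ √m := Real.one_le_sqrt.2 (by exact_mod_cast hm)
  have hm' : (0 : ℝ) < √m := one_pos.trans_le hm1
  have hsq : √(m : ℝ) ^ 2 = m := Real.sq_sqrt (Nat.cast_nonneg m)
  have i1 := (integrable_dotProduct_self m).const_mul (3 / (2 * √m))
  have i2 := (memLp_dotProduct_self m).integrable_sq.const_mul (1 / (2 * √m ^ 3))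
  have h : ∫ g : Fin m → ℝ, (3 / (2 * √m) * (g ⬝ᵥ g) - 1 / (2 * √m ^ 3) * (g ⬝ᵥ g) ^ 2)
      ∂stdGaussianPi (Fin m) ≤ gaussianMeanNorm m := by
    refine integral_mono (i1.sub i2) (integrable_sqrt_dotProduct_self m) fun g => ?_
    have hg : 0 ≤ g ⬝ᵥ g := Finset.sum_nonneg fun i _ => mul_self_nonneg _
    set t := √(g ⬝ᵥ g) with ht
    have ht0 : 0 ≤ t := Real.sqrt_nonneg _
    have e : g ⬝ᵥ g = t ^ 2 := (Real.sq_sqrt hg).symm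
    -- The quadratic in `t ^ 2` is chosen to touch `t` to first order at `t = √m`, whence the
    -- squared factor.
    have e' : t - (3 / (2 * √m) * t ^ 2 - 1 / (2 * √m ^ 3) * (t ^ 2) ^ 2) =
        t * (t - √m) ^ 2 * (t + 2 * √m) / (2 * √m ^ 3) := by
      field_simp
      ring
    have : 0 ≤ t * (t - √m) ^ 2 * (t + 2 * √m) / (2 * √m ^ 3) := by positivity
    dsimp only
    rw [e]
    linarith
  rw [integral_sub i1 i2, integral_const_mul, integral_const_mul, integral_dotProduct_self,
    integral_dotProduct_self_sq] at h
  refine le_trans ?_ h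
  have e : 3 / (2 * √m) * m - 1 / (2 * √m ^ 3) * (m ^ 2 + m * V) = √m - V / (2 * √(m : ℝ)) := by
    have : ∀ r : ℝ, 0 < r → 3 / (2 * r) * r ^ 2 - 1 / (2 * r ^ 3) * ((r ^ 2) ^ 2 + r ^ 2 * V) =
        r - V / (2 * r) := fun r hr => by field_simp; ring
    simpa only [hsq] using this _ hm'
  rw [e]
  have : V / (2 * √(m : ℝ)) ≤ V := div_le_self hV (by linarith)
  linarith

/-! ### The null objective as a Gaussian process. -/

theorem measurePreserving_scale_stdGaussianPi {ι : Type*} [Fintype ι] (v : ι → ℝ≥0) :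
    MeasurePreserving (fun (g : ι → ℝ) i => √(v i) * g i) (stdGaussianPi ι)
      (Measure.pi fun i => gaussianReal 0 (v i)) := by
  have hv : ∀ i, (gaussianReal 0 1).map (fun x => √(v i) * x) = gaussianReal 0 (v i) := fun i => by
    rw [gaussianReal_map_const_mul, mul_zero, mul_one]
    congr 1
    ext
    exact Real.sq_sqrt (v i).2
  refine ⟨by fun_prop, ?_⟩
  have : ∀ i, SigmaFinite ((gaussianReal 0 1).map fun x => √(v i) * x) := fun i => by
    rw [hv i]; infer_instance
  rw [stdGaussianPi, Measure.pi_map_pi fun i => by fun_prop]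
  simp_rw [hv]

/-- Variance of the entry of the symmetric matrix at an unordered pair. -/
noncomputable def symVariance (n : ℕ) (ρ : ℝ≥0) (e : Sym2 (Fin n)) : ℝ≥0 :=
  if e.IsDiag then 2 * ρ / (n : ℝ≥0) else ρ / (n : ℝ≥0)

/-- The null objective as a linear form in the normalised entries of the noise. -/
noncomputable def objectiveFeature {n p : ℕ} (ρ τ : ℝ≥0) (b : ℝ)
    (q : (Fin n → ℝ) × (Fin p → ℝ)) : Sym2 (Fin n) ⊕ (Fin p × Fin n) → ℝ :=
  Sum.elim
    (fun e => √(symVariance n ρ e) * ∑ r : Fin n × Fin n with s(r.1, r.2) = e, q.1 r.1 * q.1 r.2)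
    (fun r => b * √(τ / p : ℝ) * (q.2 r.1 * q.1 r.2))

/-- The doubled diagonal variance makes every ordered pair contribute equally: an off-diagonal entry
occurs twice in the quadratic form, so its square weight `4ρ/n` splits as `2ρ/n` for each order.
Hence the covariance is a function of inner products only. -/
theorem symVariance_mul_sum_mul_sum {n : ℕ} (ρ : ℝ≥0) (x x' : Fin n → ℝ) (e : Sym2 (Fin n)) :
    (symVariance n ρ e : ℝ) * ((∑ r : Fin n × Fin n with s(r.1, r.2) = e, x r.1 * x r.2) *
      ∑ r : Fin n × Fin n with s(r.1, r.2) = e, x' r.1 * x' r.2) =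
    ∑ r : Fin n × Fin n with s(r.1, r.2) = e,
      2 * ρ / n * (x r.1 * x' r.1 * (x r.2 * x' r.2)) := by
  induction e with | _ i j
  have hf : (Finset.univ.filter fun r : Fin n × Fin n => s(r.1, r.2) = s(i, j)) =
      {(i, j), (j, i)} := by
    ext ⟨a, c⟩
    simp
  rw [hf]
  by_cases hij : i = j
  · subst hij
    simp only [Finset.pair_eq_singleton, Finset.sum_singleton, symVariance, Sym2.mk_isDiag_iff,
      if_true]
    push_cast
    ring
  · have hne : ((i, j) : Fin n × Fin n) ≠ (j, i) := fun h => hij (Prod.ext_iff.1 h).1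
    simp only [Finset.sum_pair hne, symVariance, Sym2.mk_isDiag_iff, if_neg hij]
    push_cast
    ring

theorem objectiveFeature_dotProduct {n p : ℕ} (ρ τ : ℝ≥0) (b : ℝ)
    (q q' : (Fin n → ℝ) × (Fin p → ℝ)) :
    objectiveFeature ρ τ b q ⬝ᵥ objectiveFeature ρ τ b q' =
      2 * ρ / n * ((q.1 ⬝ᵥ q'.1) * (q.1 ⬝ᵥ q'.1)) +
        b ^ 2 * (τ / p) * ((q.2 ⬝ᵥ q'.2) * (q.1 ⬝ᵥ q'.1)) := by
  rw [objectiveFeature, objectiveFeature, sumElim_dotProduct_sumElim, tensor_dotProduct_tensor,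
    mul_pow, Real.sq_sqrt (by positivity)]
  congr 1
  have h1 : ∀ e : Sym2 (Fin n), (√(symVariance n ρ e) *
      ∑ r : Fin n × Fin n with s(r.1, r.2) = e, q.1 r.1 * q.1 r.2) *
      (√(symVariance n ρ e) * ∑ r : Fin n × Fin n with s(r.1, r.2) = e, q'.1 r.1 * q'.1 r.2) =
      ∑ r : Fin n × Fin n with s(r.1, r.2) = e,
        2 * ρ / n * (q.1 r.1 * q'.1 r.1 * (q.1 r.2 * q'.1 r.2)) := fun e => by
    rw [← symVariance_mul_sum_mul_sum]
    have hs := Real.mul_self_sqrt (symVariance n ρ e).coe_nonneg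
    linear_combination ((∑ r : Fin n × Fin n with s(r.1, r.2) = e, q.1 r.1 * q.1 r.2) *
      ∑ r : Fin n × Fin n with s(r.1, r.2) = e, q'.1 r.1 * q'.1 r.2) * hs
  rw [dotProduct, Finset.sum_congr rfl fun e _ => h1 e, Finset.sum_fiberwise, ← Finset.mul_sum,
    Fintype.sum_prod_type]
  simp only [dotProduct]
  rw [Finset.sum_mul_sum]

theorem objective_zero_zero_eq {n p : ℕ} (ρ τ : ℝ≥0) (b : ℝ) (v₀ : Fin n → ℝ) (u₀ : Fin p → ℝ)
    (g : Sym2 (Fin n) ⊕ (Fin p × Fin n) → ℝ) (q : (Fin n → ℝ) × (Fin p → ℝ)) :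
    objective 0 0 b v₀ u₀ (symMatrix fun e => √(symVariance n ρ e) * g (Sum.inl e))
      (rectMatrix fun r => √(τ / p : ℝ) * g (Sum.inr r)) q = objectiveFeature ρ τ b q ⬝ᵥ g := by
  rw [objectiveFeature, sumElim_dotProduct, objective]
  simp only [zero_div, zero_mul, zero_add, Real.sqrt_zero]
  congr 1
  · simp only [dotProduct, mulVec, symMatrix, of_apply, Function.comp]
    have : ∀ e : Sym2 (Fin n), (√(symVariance n ρ e) *
        ∑ r : Fin n × Fin n with s(r.1, r.2) = e, q.1 r.1 * q.1 r.2) * g (Sum.inl e) =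
        ∑ r : Fin n × Fin n with s(r.1, r.2) = e,
          √(symVariance n ρ s(r.1, r.2)) * (q.1 r.1 * q.1 r.2) * g (Sum.inl s(r.1, r.2)) := by
      intro e
      rw [Finset.mul_sum, Finset.sum_mul]
      refine Finset.sum_congr rfl fun r hr => ?_
      rw [(Finset.mem_filter.1 hr).2]
    rw [Finset.sum_congr rfl fun e _ => this e, Finset.sum_fiberwise, Fintype.sum_prod_type]
    refine Finset.sum_congr rfl fun i _ => ?_
    rw [Finset.mul_sum]
    exact Finset.sum_congr rfl fun j _ => by ring
  · simp only [dotProduct, mulVec, rectMatrix, of_apply, Function.comp]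
    rw [Fintype.sum_prod_type, Finset.mul_sum]
    refine Finset.sum_congr rfl fun i _ => ?_
    rw [Finset.mul_sum, Finset.mul_sum]
    exact Finset.sum_congr rfl fun j _ => by ring

/-- The null optimum is a Gaussian width. -/
theorem OPT_zero_zero_eq {n p : ℕ} (ρ τ : ℝ≥0) (b : ℝ) (v₀ : Fin n → ℝ) (u₀ : Fin p → ℝ) :
    OPT ρ τ v₀ u₀ 0 0 b =
      1 / (n : ℝ) * gaussianWidth fun q : SpherePair n p n p => objectiveFeature ρ τ b q.1 := by
  have hmp : MeasurePreserving (fun g : Sym2 (Fin n) ⊕ (Fin p × Fin n) → ℝ =>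
      ((fun e => √(symVariance n ρ e) * g (Sum.inl e)), fun r => √(τ / p : ℝ) * g (Sum.inr r)))
      (stdGaussianPi (Sym2 (Fin n) ⊕ (Fin p × Fin n))) (noise n p ρ τ) := by
    have h1 := measurePreserving_scale_stdGaussianPi (symVariance n ρ)
    have h2 := measurePreserving_scale_stdGaussianPi fun _ : Fin p × Fin n => τ / (p : ℝ≥0)
    have h3 := (h1.prod h2).comp measurePreserving_sum_stdGaussianPi
    exact h3
  rw [OPT, gaussianWidth, ← hmp.map_eq, integral_map hmp.measurable.aemeasurable
    (by rw [hmp.map_eq]; exact (integrable_maxValue ρ τ 0 0 b v₀ u₀).aestronglyMeasurable)]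
  congr 2
  ext g
  simp only [← objective_zero_zero_eq ρ τ b v₀ u₀]
  exact sSup_image'

/-! ### The upper bound. -/

theorem dotProduct_le_sqrt_mul_sqrt {ι : Type*} [Fintype ι] (x y : ι → ℝ) :
    x ⬝ᵥ y ≤ √(x ⬝ᵥ x) * √(y ⬝ᵥ y) := by
  rw [dotProduct_self_eq_sum_sq, dotProduct_self_eq_sum_sq]
  exact Real.sum_mul_le_sqrt_mul_sqrt _ _ _

/-- Comparison with the linear process `α ⟨x, g⟩ + β ⟨y, h⟩`, whose scales are chosen so that the
increments match to first order at `u = N`, `w = P`. -/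
theorem gaussianWidth_objectiveFeature_le {n p : ℕ} (hn : 0 < n) (hp : 0 < p) (ρ τ : ℝ≥0) {b : ℝ}
    (hb : 0 ≤ b) :
    gaussianWidth (fun q : SpherePair n p n p => objectiveFeature ρ τ b q.1) ≤
      √(4 * ρ + b ^ 2 * τ) * n + b * √(τ * n * p : ℝ) := by
  have hn' : (0 : ℝ) < n := by exact_mod_cast hn
  have hp' : (0 : ℝ) < p := by exact_mod_cast hp
  obtain ⟨n, rfl⟩ := Nat.exists_eq_add_one.2 hn
  obtain ⟨p, rfl⟩ := Nat.exists_eq_add_one.2 hp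
  set N : ℝ := ((n + 1 : ℕ) : ℝ)
  set P : ℝ := ((p + 1 : ℕ) : ℝ)
  have : Nonempty (SpherePair (n + 1) (p + 1) N P) := nonempty_spherePair _ _ hn'.le hp'.le
  set α : ℝ := √(4 * ρ + b ^ 2 * τ) with hα
  set β : ℝ := b * √(τ * N / P) with hβ
  have hα0 : 0 ≤ α := Real.sqrt_nonneg _
  have hβ0 : 0 ≤ β := by positivity
  have hα2 : α ^ 2 = 4 * ρ + b ^ 2 * τ := Real.sq_sqrt (by positivity)
  have hβ2 : β ^ 2 = b ^ 2 * (τ * N / P) := by rw [hβ, mul_pow, Real.sq_sqrt (by positivity)]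
  have hβP : β * P = b * √(τ * N * P) := by
    rw [hβ, mul_assoc]
    congr 1
    nth_rewrite 2 [← Real.sqrt_sq hp'.le]
    rw [← Real.sqrt_mul (by positivity)]
    congr 1
    field_simp
  have hfeat : ∀ (q : SpherePair (n + 1) (p + 1) N P) i,
      |Sum.elim (α • q.1.1) (β • q.1.2) i| ≤ √(α ^ 2 * N + β ^ 2 * P) := by
    refine abs_le_of_forall_dotProduct_self_eq fun q => ?_
    rw [sumElim_dotProduct_sumElim]
    simp only [smul_dotProduct, dotProduct_smul, smul_eq_mul, q.2.1, q.2.2]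
    ring
  calc gaussianWidth (fun q : SpherePair (n + 1) (p + 1) N P => objectiveFeature ρ τ b q.1)
      ≤ gaussianWidth (fun q : SpherePair (n + 1) (p + 1) N P =>
          Sum.elim (α • q.1.1) (β • q.1.2)) := by
        refine gaussianWidth_le (abs_le_of_forall_dotProduct_self_eq (R := 2 * ρ / N * (N * N) +
          b ^ 2 * (τ / P) * (P * N)) fun q => ?_) hfeat fun q q' => ?_
        · rw [objectiveFeature_dotProduct, q.2.1, q.2.2]
        · simp only [dotProduct_sub_self, objectiveFeature_dotProduct, sumElim_dotProduct_sumElim,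
            smul_dotProduct, dotProduct_smul, smul_eq_mul, q.2.1, q.2.2, q'.2.1, q'.2.2]
          set u := q.1.1 ⬝ᵥ q'.1.1 with hu
          set w := q.1.2 ⬝ᵥ q'.1.2 with hw
          have hu' : u ≤ N := by
            have := dotProduct_le_sqrt_mul_sqrt q.1.1 q'.1.1
            rwa [q.2.1, q'.2.1, Real.mul_self_sqrt hn'.le] at this
          have hw' : w ≤ P := by
            have := dotProduct_le_sqrt_mul_sqrt q.1.2 q'.1.2
            rwa [q.2.2, q'.2.2, Real.mul_self_sqrt hp'.le] at this
          -- The excess of the linear increments is a square plus a product of two factors that are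
          -- nonnegative by Cauchy–Schwarz.
          have e : α * (α * N) + β * (β * P) + (α * (α * N) + β * (β * P)) -
              2 * (α * (α * u) + β * (β * w)) -
              (2 * ρ / N * (N * N) + b ^ 2 * (τ / P) * (P * N) +
                (2 * ρ / N * (N * N) + b ^ 2 * (τ / P) * (P * N)) -
                2 * (2 * ρ / N * (u * u) + b ^ 2 * (τ / P) * (w * u))) =
              4 * ρ / N * (N - u) ^ 2 + 2 * b ^ 2 * (τ / P) * ((N - u) * (P - w)) := by
            have : α * (α * N) + β * (β * P) + (α * (α * N) + β * (β * P)) -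
              2 * (α * (α * u) + β * (β * w)) = α ^ 2 * (2 * N - 2 * u) +
                β ^ 2 * (2 * P - 2 * w) := by ring
            rw [this, hα2, hβ2]
            field_simp
            ring
          have h0 : 0 ≤ 4 * ρ / N * (N - u) ^ 2 + 2 * b ^ 2 * (τ / P) * ((N - u) * (P - w)) := by
            have := mul_nonneg (sub_nonneg.2 hu') (sub_nonneg.2 hw')
            positivity
          linarith
    _ ≤ ∫ g : Fin (n + 1) ⊕ Fin (p + 1) → ℝ,
          (α * √N * √((g ∘ Sum.inl) ⬝ᵥ (g ∘ Sum.inl)) +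
            β * √P * √((g ∘ Sum.inr) ⬝ᵥ (g ∘ Sum.inr))) ∂stdGaussianPi _ := by
        refine integral_mono (integrable_iSup_dotProduct hfeat) (Integrable.add
          (Integrable.const_mul ?_ _) (Integrable.const_mul ?_ _)) fun g => ciSup_le fun q => ?_
        · exact (measurePreserving_fst.comp measurePreserving_sum_stdGaussianPi
            ).integrable_comp_of_integrable (integrable_sqrt_dotProduct_self _)
        · exact (measurePreserving_snd.comp measurePreserving_sum_stdGaussianPi
            ).integrable_comp_of_integrable (integrable_sqrt_dotProduct_self _)
        · rw [sumElim_dotProduct, smul_dotProduct, smul_dotProduct, smul_eq_mul, smul_eq_mul,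
            mul_assoc α, mul_assoc β]
          have h1 := dotProduct_le_sqrt_mul_sqrt q.1.1 (g ∘ Sum.inl)
          have h2 := dotProduct_le_sqrt_mul_sqrt q.1.2 (g ∘ Sum.inr)
          rw [q.2.1] at h1
          rw [q.2.2] at h2
          exact add_le_add (mul_le_mul_of_nonneg_left h1 hα0) (mul_le_mul_of_nonneg_left h2 hβ0)
    _ = α * √N * gaussianMeanNorm (n + 1) + β * √P * gaussianMeanNorm (p + 1) := by
        rw [integral_add, integral_const_mul, integral_const_mul,
          integral_comp_inl_stdGaussianPi (f := fun g : Fin (n + 1) → ℝ => √(g ⬝ᵥ g))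
            (by unfold dotProduct; fun_prop),
          integral_comp_inr_stdGaussianPi (f := fun g : Fin (p + 1) → ℝ => √(g ⬝ᵥ g))
            (by unfold dotProduct; fun_prop)]
        · rfl
        · exact ((measurePreserving_fst.comp measurePreserving_sum_stdGaussianPi
            ).integrable_comp_of_integrable (integrable_sqrt_dotProduct_self _)).const_mul _
        · exact ((measurePreserving_snd.comp measurePreserving_sum_stdGaussianPi
            ).integrable_comp_of_integrable (integrable_sqrt_dotProduct_self _)).const_mul _
    _ ≤ α * √N * √N + β * √P * √P := by
        gcongr
        · exact gaussianMeanNorm_le _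
        · exact gaussianMeanNorm_le _
    _ = α * N + b * √(τ * N * P) := by
        rw [mul_assoc, mul_assoc, Real.mul_self_sqrt hn'.le, Real.mul_self_sqrt hp'.le, hβP]

/-! ### The lower bound. -/

/-- Stretching pinned pairs from squared radius `k + 1` to the two spheres embeds them as a
sub-family of the full process. The constants are those for which the covariances coincide. -/
theorem pinnedWidth_le_gaussianWidth_objectiveFeature (n p k : ℕ)
    (ρ τ : ℝ≥0) (b : ℝ) :
    pinnedWidth (√(2 * ρ * (n + 2 : ℕ)) / (k + 1)) (b * √(τ * (n + 2 : ℕ)) / (k + 1))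
      (n + 1) (p + 1) k ≤
      gaussianWidth fun q : SpherePair (n + 2) (p + 1) (n + 2 : ℕ) (p + 1 : ℕ) =>
        objectiveFeature ρ τ b q.1 := by
  set N : ℝ := ((n + 2 : ℕ) : ℝ) with hN
  set P : ℝ := ((p + 1 : ℕ) : ℝ) with hP
  have hN0 : 0 < N := by positivity
  have hP0 : 0 < P := by positivity
  have hk : (0 : ℝ) < k + 1 := by positivity
  have : Nonempty (SpherePair (n + 2) (p + 1) N P) := nonempty_spherePair _ _ hN0.le hP0.le
  have : Nonempty (SpherePair (n + 1) (p + 1) k (k + 1)) :=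
    nonempty_spherePair _ _ (by positivity) (by positivity)
  have hb : ∀ (q : SpherePair (n + 2) (p + 1) N P) i, |objectiveFeature ρ τ b q.1 i| ≤
      √(2 * ρ / N * (N * N) + b ^ 2 * (τ / P) * (P * N)) :=
    abs_le_of_forall_dotProduct_self_eq fun q => by
      rw [objectiveFeature_dotProduct, q.2.1, q.2.2]
  have hsN : √(N / (k + 1)) * √(N / (k + 1)) = N / (k + 1) := Real.mul_self_sqrt (by positivity)
  have hsP : √(P / (k + 1)) * √(P / (k + 1)) = P / (k + 1) := Real.mul_self_sqrt (by positivity)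
  let r : SpherePair (n + 1) (p + 1) k (k + 1) → SpherePair (n + 2) (p + 1) N P := fun q =>
    ⟨(√(N / (k + 1)) • vecCons 1 q.1.1, √(P / (k + 1)) • q.1.2), by
      rw [smul_dotProduct, dotProduct_smul, cons_dotProduct_cons, q.2.1, smul_smul, smul_eq_mul,
        hsN]
      field_simp
      ring, by
      rw [smul_dotProduct, dotProduct_smul, q.2.2, smul_smul, smul_eq_mul, hsP]
      field_simp⟩
  refine le_trans ?_ (gaussianWidth_comp_le hb r)
  have hcov : ∀ q q' : SpherePair (n + 1) (p + 1) k (k + 1),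
      quadraticFeature (√(2 * ρ * N) / (k + 1)) (b * √(τ * N) / (k + 1)) (vecCons 1 q.1.1) q.1.2 ⬝ᵥ
        quadraticFeature (√(2 * ρ * N) / (k + 1)) (b * √(τ * N) / (k + 1))
          (vecCons 1 q'.1.1) q'.1.2 =
      objectiveFeature ρ τ b (r q).1 ⬝ᵥ objectiveFeature ρ τ b (r q').1 := by
    intro q q'
    have hN' : ∀ u, √(N / (k + 1)) * (√(N / (k + 1)) * u) = N / (k + 1) * u := fun u => by
      rw [← mul_assoc, hsN]
    have hP' : ∀ u, √(P / (k + 1)) * (√(P / (k + 1)) * u) = P / (k + 1) * u := fun u => by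
      rw [← mul_assoc, hsP]
    rw [quadraticFeature_dotProduct, objectiveFeature_dotProduct, ← hN, ← hP]
    simp only [r, smul_dotProduct, dotProduct_smul, smul_eq_mul, hN', hP']
    rw [div_pow, div_pow, mul_pow, Real.sq_sqrt (by positivity), Real.sq_sqrt (by positivity)]
    field_simp
  refine gaussianWidth_le (C := √(2 * ρ / N * (N * N) + b ^ 2 * (τ / P) * (P * N)))
    (fun q i => ?_) (fun q => hb (r q)) fun q q' => ?_
  · refine abs_apply_le_sqrt_of_dotProduct_self_le
      (R := 2 * ρ / N * (N * N) + b ^ 2 * (τ / P) * (P * N)) ?_ i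
    rw [hcov, objectiveFeature_dotProduct, (r q).2.1, (r q).2.2]
  · rw [dotProduct_sub_self, dotProduct_sub_self, hcov, hcov, hcov]

theorem OPT_zero_zero_le {n p : ℕ} (hn : 0 < n) (hp : 0 < p) (ρ τ : ℝ≥0) {b : ℝ} (hb : 0 ≤ b)
    (v₀ : Fin n → ℝ) (u₀ : Fin p → ℝ) :
    OPT ρ τ v₀ u₀ 0 0 b ≤ √(4 * ρ + b ^ 2 * τ) + b * √(τ / (n / p : ℝ)) := by
  have hn' : (0 : ℝ) < n := by exact_mod_cast hn
  have hp' : (0 : ℝ) < p := by exact_mod_cast hp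
  rw [OPT_zero_zero_eq, one_div_mul_eq_div, div_le_iff₀ hn']
  refine (gaussianWidth_objectiveFeature_le hn hp ρ τ hb).trans_eq ?_
  have : √(τ * n * p : ℝ) = √(τ / (n / p : ℝ)) * n := by
    nth_rewrite 3 [← Real.sqrt_sq hn'.le]
    rw [← Real.sqrt_mul (by positivity)]
    congr 1
    field_simp
  rw [this]
  ring

theorem le_OPT_zero_zero {n p k : ℕ} (hn : k + 2 ≤ n) (hp : k + 1 ≤ p) (ρ τ : ℝ≥0) {b : ℝ}
    (hb : 0 ≤ b) (v₀ : Fin n → ℝ) (u₀ : Fin p → ℝ) :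
    k / (k + 1) * (√(4 * ρ + b ^ 2 * τ) + b * √(τ / (n / p : ℝ)) -
      (√k + Var[fun x : ℝ => x ^ 2; gaussianReal 0 1]) * (b * √τ + √(4 * ρ + b ^ 2 * τ)) / √n) ≤
      OPT ρ τ v₀ u₀ 0 0 b := by
  have hn' : (0 : ℝ) < n := by exact_mod_cast (by omega : 0 < n)
  have hp' : (0 : ℝ) < p := by exact_mod_cast (by omega : 0 < p)
  have hk : (0 : ℝ) < k + 1 := by positivity
  rw [OPT_zero_zero_eq, one_div_mul_eq_div, le_div_iff₀ hn']
  set V := Var[fun x : ℝ => x ^ 2; gaussianReal 0 1] with hV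
  set α := √(4 * ρ + b ^ 2 * τ : ℝ) with hα
  have hα0 : 0 ≤ α := Real.sqrt_nonneg _
  have hα2 : α ^ 2 = 4 * ρ + b ^ 2 * τ := Real.sq_sqrt (by positivity)
  -- The rounds lower each dimension by at most `k`, which costs at most `√k` in the norm.
  have hnorm : ∀ N m : ℕ, N ≤ m + k → 0 < m → √(N : ℝ) - √k - V ≤ gaussianMeanNorm m := by
    intro N m h hm
    refine le_trans ?_ (le_gaussianMeanNorm hm)
    have h1 : √(N : ℝ) ≤ √(m + k : ℝ) := Real.sqrt_le_sqrt (by exact_mod_cast h)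
    have h2 : √(m + k : ℝ) ≤ √m + √k := by
      rw [Real.sqrt_le_left (by positivity)]
      nlinarith [Real.sq_sqrt (Nat.cast_nonneg (α := ℝ) m), Real.sq_sqrt (Nat.cast_nonneg (α := ℝ) k),
        mul_nonneg (Real.sqrt_nonneg (m : ℝ)) (Real.sqrt_nonneg (k : ℝ))]
    linarith
  obtain ⟨n', rfl⟩ : ∃ n', n = n' + k + 2 := ⟨n - (k + 2), by omega⟩
  obtain ⟨p', rfl⟩ : ∃ p', p = p' + k + 1 := ⟨p - (k + 1), by omega⟩
  set N : ℝ := ((n' + k + 2 : ℕ) : ℝ) with hN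
  set P : ℝ := ((p' + k + 1 : ℕ) : ℝ) with hP
  have hL : (α * √N / (k + 1)) ^ 2 =
      2 * (√(2 * ρ * N) / (k + 1)) ^ 2 + (b * √(τ * N) / (k + 1)) ^ 2 := by
    rw [div_pow, div_pow, div_pow, mul_pow, mul_pow, hα2, Real.sq_sqrt hn'.le,
      Real.sq_sqrt (by positivity : 0 ≤ 2 * ρ * N), Real.sq_sqrt (by positivity : 0 ≤ τ * N)]
    ring
  refine le_trans ?_ ((sum_gaussianMeanNorm_le_pinnedWidth hL n' p' k).trans
    (pinnedWidth_le_gaussianWidth_objectiveFeature (n' + k) (p' + k) k ρ τ b))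
  have hsum : k * (b * √(τ * N) / (k + 1) * (√P - √k - V) + α * √N / (k + 1) * (√N - √k - V)) ≤
      ∑ j ∈ Finset.range k, (b * √(τ * N) / (k + 1) * gaussianMeanNorm (p' + j + 2) +
        α * √N / (k + 1) * gaussianMeanNorm (n' + j + 2)) := by
    rw [← nsmul_eq_mul]
    nth_rewrite 1 [← Finset.card_range k]
    refine Finset.card_nsmul_le_sum _ _ _ fun j _ => ?_
    have h1 := hnorm (p' + k + 1) (p' + j + 2) (by omega) (by omega)
    have h2 := hnorm (n' + k + 2) (n' + j + 2) (by omega) (by omega)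
    gcongr
  refine le_trans (le_of_eq ?_) hsum
  have e1 : √(τ / (N / P)) = √τ * √P / √N := by
    rw [← Real.sqrt_mul (by positivity), ← Real.sqrt_div (by positivity)]
    congr 1
    field_simp
  have e2 : √(τ * N) = √τ * √N := Real.sqrt_mul (by positivity) _
  have e3 : N = √N ^ 2 := (Real.sq_sqrt hn'.le).symm
  have hsN : 0 < √N := Real.sqrt_pos.2 hn'
  rw [e1, e2]
  nth_rewrite 3 [e3]
  field_simp
  ring

/-! ### The limit. -/

theorem mainTheorem8 (ρ τ : ℝ≥0) (b γ : ℝ) (hb : 0 ≤ b) (hγ : 0 < γ)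
    (n p : ℕ → ℕ) (hn : Tendsto n atTop atTop) (hp : Tendsto p atTop atTop)
    (hnp : Tendsto (fun k => (n k : ℝ) / (p k : ℝ)) atTop (𝓝 γ))
    (v₀ : ∀ k, Fin (n k) → ℝ) (hv₀ : ∀ k i, v₀ k i = 1 ∨ v₀ k i = -1)
    (u₀ : ∀ k, Fin (p k) → ℝ) (hu₀ : ∀ k, u₀ k ∈ normSphere (p k)) :
    Tendsto (fun k => OPT ρ τ (v₀ k) (u₀ k) 0 0 b) atTop
      (𝓝 (√(4 * (ρ : ℝ) + b ^ 2 * (τ : ℝ)) + b * √((τ : ℝ) / γ))) := by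
  have hup : Tendsto (fun k => √(4 * (ρ : ℝ) + b ^ 2 * (τ : ℝ)) +
      b * √((τ : ℝ) / (n k / p k : ℝ))) atTop
      (𝓝 (√(4 * (ρ : ℝ) + b ^ 2 * (τ : ℝ)) + b * √((τ : ℝ) / γ))) :=
    tendsto_const_nhds.add ((tendsto_const_nhds.div hnp hγ.ne').sqrt.const_mul b)
  refine tendsto_order.2 ⟨fun a ha => ?_, fun a ha => ?_⟩
  · have hfrac : Tendsto (fun m : ℕ => (m / (m + 1) : ℝ) *
        (√(4 * (ρ : ℝ) + b ^ 2 * (τ : ℝ)) + b * √((τ : ℝ) / γ))) atTop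
        (𝓝 (1 * (√(4 * (ρ : ℝ) + b ^ 2 * (τ : ℝ)) + b * √((τ : ℝ) / γ)))) :=
      (tendsto_natCast_div_add_atTop (1 : ℝ)).mul_const _
    rw [one_mul] at hfrac
    -- The number of rounds `m` is fixed before the dimensions grow, so the error term, of order
    -- `1/√n`, vanishes.
    obtain ⟨m, hm⟩ := (hfrac.eventually (eventually_gt_nhds ha)).exists
    have hsqrt : Tendsto (fun k => √(n k : ℝ)) atTop atTop :=
      Real.tendsto_sqrt_atTop.comp (tendsto_natCast_atTop_atTop.comp hn)
    have hlow := (hup.sub (tendsto_const_nhds (x := (√(m : ℝ) +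
      Var[fun x : ℝ => x ^ 2; gaussianReal 0 1]) * (b * √τ + √(4 * ρ + b ^ 2 * τ)))
      |>.div_atTop hsqrt)).const_mul (m / (m + 1) : ℝ)
    rw [sub_zero] at hlow
    filter_upwards [hlow.eventually (eventually_gt_nhds hm), hn.eventually_ge_atTop (m + 2),
      hp.eventually_ge_atTop (m + 1)] with k h1 h2 h3
    exact h1.trans_le (le_OPT_zero_zero h2 h3 ρ τ hb (v₀ k) (u₀ k))
  · filter_upwards [hup.eventually (eventually_lt_nhds ha), hn.eventually_gt_atTop 0,
      hp.eventually_gt_atTop 0] with k h1 h2 h3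
    exact (OPT_zero_zero_le h2 h3 ρ τ hb (v₀ k) (u₀ k)).trans_lt h1
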